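/- A \emph{rational polygon} $P\subset\mathbb{R}^2$ is the convex hull of finitely many rational points, not all contained in a line. By Ehrhart's theorem there are unique periodic functions $c_{P,0},c_{P,1},c_{P,2}\colon\mathbb{Z}\to\mathbb{Q}$, with $c_{P,2}\not\equiv 0$, such that $|nP\cap\mathbb{Z}^2| = c_{P,0}(n)+c_{P,1}(n)\,n+c_{P,2}(n)\,n^2$ for all positive integers $n$; the \emph{quasi-period} of $P$ is the least common multiple of the minimum periods of $c_{P,0},c_{P,1},c_{P,2}$. A \emph{polygonal pseudo-integral polytope} (polygonal PIP) is a rational polygon with quasi-period $1$, that is, one whose Ehrhart quasi-polynomial is a polynomial. Let $I_P$ and $b_P$ denote the numbers of points of $\mathbb{Z}^2$ in the interior and on the boundary of $P$, respectively. Theorem. For all integers $I\ge 1$ and $b\in\{1,2\}$ there exists a polygonal PIP $P$ with $(I_P,b_P)=(I,b)$. However, there does not exist a polygonal PIP $P$ with $b_P=0$, nor one with $(I_P,b_P)\in\{(0,1),(0,2)\}$. -/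

import Mathlib

open scoped Pointwise

noncomputable section

/-- The integer lattice `ℤ²` inside the plane `ℝ²`. -/
def integerLattice : Set (ℝ × ℝ) :=
  Set.range fun z : ℤ × ℤ => ((z.1 : ℝ), (z.2 : ℝ))

/-- A rational (convex) polygon: the convex hull of finitely many rational points of the plane,
not all contained in a line. -/
def IsRationalPolygon (P : Set (ℝ × ℝ)) : Prop :=
  ∃ S : Finset (ℚ × ℚ),
    ¬ Collinear ℝ ((fun q : ℚ × ℚ => ((q.1 : ℝ), (q.2 : ℝ))) '' (S : Set (ℚ × ℚ))) ∧
    P = convexHull ℝ ((fun q : ℚ × ℚ => ((q.1 : ℝ), (q.2 : ℝ))) '' (S : Set (ℚ × ℚ)))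

/-- The lattice-point enumerator `n ↦ |nP ∩ ℤ²|`. -/
def latticePointEnumerator (P : Set (ℝ × ℝ)) (n : ℕ) : ℕ :=
  (((n : ℝ) • P) ∩ integerLattice).ncard

/-- `c 0`, `c 1`, `c 2` are the coefficient functions of the Ehrhart quasi-polynomial of `P`:
periodic functions `ℤ → ℚ`, with `c 2` not identically zero, such that
`|nP ∩ ℤ²| = c 0 n + c 1 n * n + c 2 n * n ^ 2` for all positive integers `n`.
(A periodic function on `ℤ` is determined by its values at positive integers, and there is at most
one such triple `c`.) -/
structure IsEhrhartCoefficients (P : Set (ℝ × ℝ)) (c : Fin 3 → ℤ → ℚ) : Prop where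
  periodic : ∀ i, ∃ s : ℕ, 0 < s ∧ Function.Periodic (c i) (s : ℤ)
  leading_ne_zero : c 2 ≠ 0
  eval : ∀ n : ℕ, 0 < n →
    (latticePointEnumerator P n : ℚ) = c 0 n + c 1 n * (n : ℚ) + c 2 n * (n : ℚ) ^ 2

/-- The minimum period of a periodic function on `ℤ`. -/
def minimumPeriod (f : ℤ → ℚ) : ℕ :=
  sInf {s : ℕ | 0 < s ∧ Function.Periodic f (s : ℤ)}

/-- The quasi-period: the least common multiple of the minimum periods of the coefficient
functions. -/
def quasiPeriod (c : Fin 3 → ℤ → ℚ) : ℕ :=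
  Nat.lcm (minimumPeriod (c 0)) (Nat.lcm (minimumPeriod (c 1)) (minimumPeriod (c 2)))

/-- A polygonal pseudo-integral polytope (polygonal PIP): a rational polygon whose Ehrhart
quasi-polynomial has quasi-period `1`. -/
def IsPolygonalPIP (P : Set (ℝ × ℝ)) : Prop :=
  IsRationalPolygon P ∧ ∃ c : Fin 3 → ℤ → ℚ, IsEhrhartCoefficients P c ∧ quasiPeriod c = 1

/-- The number of lattice points in the interior of `P`. -/
def interiorCount (P : Set (ℝ × ℝ)) : ℕ :=
  (interior P ∩ integerLattice).ncard

/-- The number of lattice points on the boundary of `P`. -/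
def boundaryCount (P : Set (ℝ × ℝ)) : ℕ :=
  (frontier P ∩ integerLattice).ncard

end

/-! # Lattice-point counts of polygonal pseudo-integral polytopes

**Non-existence.** Everything follows from Pick's theorem for a polygonal PIP `P`
(`IsPolygonalPIP.exists_coefficients`): its Ehrhart polynomial is `1 + a n + c n ^ 2` with `c > 0`,
`a ≠ 0`, `b_P = 2 a` and `I_P = 1 - a + c`. So `b_P = 0` is impossible, and `I_P = 0` with
`b_P ∈ {1, 2}` would give `c = a - 1 ≤ 0`. Pick's theorem in turn is Ehrhart–Macdonald reciprocity
for rational polygons (`exists_isQuasiPolynomial_reciprocity`): one quasi-polynomial `E` on all of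
`ℤ` counts the lattice points of `n P` at `n > 0` and those of the interior of `n P` at `-n < 0`,
and `E 0 = 1`. If the Ehrhart quasi-polynomial is a polynomial, then it agrees with `E` everywhere,
since a quasi-polynomial that vanishes at all large integers is zero. The boundary of `n P` then
contains `2 a n` lattice points; this is positive when `n P` has a vertex in `ℤ²`, whence `a ≠ 0`.

Reciprocity is proved in homogeneous coordinates, for the cone over `P` in `ℝ³`. By Carathéodory's
theorem this cone is a union of simplicial cones, and since simplicial cones cut by a plane are
again combinations of simplicial cones, its indicator function is a combination of indicator
functions of simplicial cones off finitely many planes (`isConeCombination_coneOver`). To get rid of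
the exceptional planes, choose a lattice point `w` in the interior of the cone and on none of them.
A lattice point `v` of positive height lies in the cone iff `k v + w` does for all large `k`; if `v`
has negative height, then `-v` lies in the interior of the cone iff `-(k v + w)` lies in the cone
for all large `k`. For one simplicial cone with generators `A₀, A₁, A₂` and facet functionals `l₀,
l₁, l₂`, write `σᵢ v` for the indicator of `0 < lᵢ (k v + w)`, `k` large. The differences in the
directions `A₀, A₁, A₂` send `∏ σᵢ` and `∏ (1 - σᵢ)` to opposite functions, since `σᵢ` changes only
in direction `Aᵢ`; so they annihilate `∏ σᵢ + ∏ (1 - σᵢ)`, and the sums of this function over the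
planes of constant height satisfy the recurrence of a quasi-polynomial
(`SimplicialCone.isQuasiPolynomial_doubleCone`).

**Existence.** For `e = 2 I + b - 2` the kite with vertices `(0, 0)`, `((e + 2) / 2, 0)` and
`(1, ± e / (e + 2))` has the lattice points `(1, 0), …, (I, 0)` in its interior, and on its boundary
`(0, 0)`, and also `(I + 1, 0)` if `b = 2`. A piecewise unimodular map carries the upper half of its
`n`-th dilate to the triangle `0 ≤ i ≤ n`, `0 ≤ 2 j ≤ e i` (`image_unstraighten`), so that the count
is twice that of the triangle minus that of the long diagonal. Both depend on parities if `e` is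
odd, but the dependence cancels, and the count is `1 + b n / 2 + e n ^ 2 / 2`.
-/

noncomputable section

open Filter Polynomial Matrix Topology

/-! ### Quasi-polynomials on the integers -/

/-- The backward shift `(S f) n = f (n - 1)` on functions `ℤ → ℚ`. -/
def backwardShift : Module.End ℚ (ℤ → ℚ) where
  toFun f n := f (n - 1)
  map_add' _ _ := rfl
  map_smul' _ _ := rfl

lemma backwardShift_pow_apply (h : ℕ) (f : ℤ → ℚ) (n : ℤ) :
    (backwardShift ^ h) f n = f (n - h) := by
  induction h generalizing n with
  | zero => simp
  | succ h ih =>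
    rw [pow_succ', Module.End.mul_apply]
    change (backwardShift ^ h) f (n - 1) = _
    rw [ih]; congr 1; push_cast; ring

/-- The multiplicative monoid of polynomials generated by the `1 - X ^ h` with `h > 0`. -/
def periodPolynomials : Submonoid ℚ[X] :=
  Submonoid.closure {p | ∃ h : ℕ, 0 < h ∧ p = 1 - X ^ h}

/-- A quasi-polynomial on `ℤ`, encoded by its linear recurrence: a product of operators
`f ↦ f - f (· - h)`, `h > 0`, annihilates it. -/
def IsQuasiPolynomial (f : ℤ → ℚ) : Prop :=
  ∃ p ∈ periodPolynomials, aeval backwardShift p f = 0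

lemma aeval_one_sub_X_pow_apply (h : ℕ) (f : ℤ → ℚ) (n : ℤ) :
    aeval backwardShift (1 - X ^ h : ℚ[X]) f n = f n - f (n - h) := by
  simp [backwardShift_pow_apply]

lemma one_sub_X_pow_mem {h : ℕ} (hh : 0 < h) : (1 - X ^ h : ℚ[X]) ∈ periodPolynomials :=
  Submonoid.subset_closure ⟨h, hh, rfl⟩

lemma isQuasiPolynomial_zero : IsQuasiPolynomial 0 := ⟨1, one_mem _, by simp⟩

lemma IsQuasiPolynomial.add {f g : ℤ → ℚ} (hf : IsQuasiPolynomial f) (hg : IsQuasiPolynomial g) :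
    IsQuasiPolynomial (f + g) := by
  obtain ⟨p, hp, hpf⟩ := hf
  obtain ⟨q, hq, hqg⟩ := hg
  refine ⟨p * q, mul_mem hp hq, ?_⟩
  rw [map_add, mul_comm p q, map_mul, Module.End.mul_apply, hpf, ← map_mul, mul_comm q p, map_mul,
    Module.End.mul_apply, hqg]
  simp

lemma IsQuasiPolynomial.smul {f : ℤ → ℚ} (a : ℚ) (hf : IsQuasiPolynomial f) :
    IsQuasiPolynomial (a • f) := by
  obtain ⟨p, hp, hpf⟩ := hf
  exact ⟨p, hp, by rw [map_smul, hpf, smul_zero]⟩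

/-- If the difference `f - f (· - h)` is a quasi-polynomial, then so is `f`. -/
lemma IsQuasiPolynomial.of_sub_shift {f g : ℤ → ℚ} {h : ℕ} (hh : 0 < h)
    (hg : IsQuasiPolynomial g) (hfg : ∀ n, g n = f n - f (n - h)) : IsQuasiPolynomial f := by
  obtain ⟨p, hp, hpg⟩ := hg
  refine ⟨p * (1 - X ^ h), mul_mem hp (one_sub_X_pow_mem hh), ?_⟩
  have : aeval backwardShift (1 - X ^ h : ℚ[X]) f = g := by
    ext n; rw [aeval_one_sub_X_pow_apply, hfg]
  rw [map_mul, Module.End.mul_apply, this, hpg]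

lemma isQuasiPolynomial_quadratic (a b c : ℚ) :
    IsQuasiPolynomial fun n : ℤ => a + b * n + c * (n : ℚ) ^ 2 := by
  refine .of_sub_shift (h := 1) (g := fun n => b - c + 2 * c * n) one_pos ?_
    fun n => by push_cast; ring
  refine .of_sub_shift (h := 1) (g := fun _ => 2 * c) one_pos ?_ fun n => by push_cast; ring
  exact .of_sub_shift (h := 1) (g := 0) one_pos isQuasiPolynomial_zero fun n => by simp

lemma eventually_aeval_backwardShift_eq_zero {f : ℤ → ℚ} (h0 : ∀ᶠ n in atTop, f n = 0)
    (p : ℚ[X]) : ∀ᶠ n in atTop, aeval backwardShift p f n = 0 := by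
  induction p using Polynomial.induction_on' with
  | add p q hp hq =>
    filter_upwards [hp, hq] with n h1 h2
    simp [h1, h2]
  | monomial k a =>
    have := (tendsto_atTop_add_const_right atTop (-(k : ℤ)) tendsto_id).eventually h0
    filter_upwards [this] with n hn
    rw [aeval_monomial, Module.End.mul_apply, Module.algebraMap_end_apply, Pi.smul_apply,
      backwardShift_pow_apply]
    simp only [id, ← sub_eq_add_neg] at hn
    simp [hn]

/-- A quasi-polynomial on `ℤ` that vanishes at all large integers vanishes everywhere. -/
lemma IsQuasiPolynomial.eq_zero {f : ℤ → ℚ} (hf : IsQuasiPolynomial f)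
    (h0 : ∀ᶠ n in atTop, f n = 0) : f = 0 := by
  obtain ⟨p, hp, hpf⟩ := hf
  induction hp using Submonoid.closure_induction generalizing f with
  | one => simpa using hpf
  | mem p hp =>
    obtain ⟨h, hh, rfl⟩ := hp
    obtain ⟨N, hN⟩ := eventually_atTop.1 h0
    have step (n : ℤ) : f n = f (n + h) := by
      have := congrFun hpf (n + h)
      rw [aeval_one_sub_X_pow_apply] at this
      simp only [add_sub_cancel_right, Pi.zero_apply] at this
      linarith
    have steps (n : ℤ) (k : ℕ) : f n = f (n + k * h) := by
      induction k with
      | zero => simp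
      | succ k ih => rw [ih, step]; congr 1; push_cast; ring
    ext n
    rw [steps n (N - n).toNat]
    apply hN
    have h1 : N - n ≤ ((N - n).toNat : ℤ) := Int.self_le_toNat _
    have h2 : (1 : ℤ) ≤ h := by exact_mod_cast hh
    nlinarith [Int.natCast_nonneg (N - n).toNat]
  | mul p q _ _ ihp ihq =>
    rw [mul_comm, map_mul, Module.End.mul_apply] at hpf
    refine ihp h0 (ihq ?_ hpf)
    exact eventually_aeval_backwardShift_eq_zero h0 p

/-! ### Simplicial cones and their combinations -/

/-- A full-dimensional rational simplicial cone in `ℝ³`, pointed upwards, given by integral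
generators `gen` of positive height (last coordinate) together with integral inner normals `fac` of
the facets, `fac i` being the normal of the facet opposite to `gen i`. -/
structure SimplicialCone where
  gen : Fin 3 → Fin 3 → ℤ
  fac : Fin 3 → Fin 3 → ℤ
  orth : ∀ i j, i ≠ j → fac i ⬝ᵥ gen j = 0
  pos : ∀ i, 0 < fac i ⬝ᵥ gen i
  height_pos : ∀ i, 0 < gen i 2

/-- The indicator function of the open half-space `{z | 0 < ℓ ⬝ᵥ z}`. -/
def halfSpace (l z : Fin 3 → ℤ) : ℤ := if 0 < l ⬝ᵥ z then 1 else 0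

namespace SimplicialCone

/-- The indicator function of the interior of a simplicial cone. -/
def indicator (T : SimplicialCone) (z : Fin 3 → ℤ) : ℤ := ∏ i, halfSpace (T.fac i) z

/-- The expansion of `z` in the basis `T.gen`, evaluated at a linear functional `l`. -/
lemma expand (T : SimplicialCone) (l z : Fin 3 → ℤ) :
    ((l ⬝ᵥ z : ℤ) : ℚ) =
      ∑ j, ((T.fac j ⬝ᵥ z : ℤ) : ℚ) / ((T.fac j ⬝ᵥ T.gen j : ℤ) : ℚ) *
        ((l ⬝ᵥ T.gen j : ℤ) : ℚ) := by
  set F : Matrix (Fin 3) (Fin 3) ℚ :=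
    .of fun i k => (T.fac i k : ℚ) / ((T.fac i ⬝ᵥ T.gen i : ℤ) : ℚ) with hF
  set G : Matrix (Fin 3) (Fin 3) ℚ := .of fun k j => (T.gen j k : ℚ) with hG
  have hFG : F * G = 1 := by
    ext i j
    have : (F * G) i j = ((T.fac i ⬝ᵥ T.gen j : ℤ) : ℚ) / ((T.fac i ⬝ᵥ T.gen i : ℤ) : ℚ) := by
      simp only [Matrix.mul_apply, hF, hG, Matrix.of_apply, dotProduct, Fin.sum_univ_three]
      push_cast; ring
    rw [this]
    by_cases hij : i = j
    · subst hij
      have : ((T.fac i ⬝ᵥ T.gen i : ℤ) : ℚ) ≠ 0 := by exact_mod_cast (T.pos i).ne'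
      rw [div_self this, Matrix.one_apply_eq]
    · rw [T.orth i j hij, Matrix.one_apply_ne hij]; simp
  have hGF : G * F = 1 := mul_eq_one_comm.1 hFG
  have h1 : (fun k => (z k : ℚ)) = (G * F) *ᵥ fun k => (z k : ℚ) := by rw [hGF, one_mulVec]
  have h2 (k : Fin 3) : (z k : ℚ) = ((G * F) *ᵥ fun k => (z k : ℚ)) k := congrFun h1 k
  have h3 : ((l ⬝ᵥ z : ℤ) : ℚ) = ∑ k, (l k : ℚ) * z k := by simp [dotProduct]
  rw [h3, Finset.sum_congr rfl fun k _ => congrArg ((l k : ℚ) * ·) (h2 k)]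
  simp only [Matrix.mul_apply, mulVec, hF, hG, Matrix.of_apply, dotProduct, Fin.sum_univ_three]
  push_cast
  ring

lemma eq_of_forall_fac (T : SimplicialCone) {y z : Fin 3 → ℤ}
    (h : ∀ i, T.fac i ⬝ᵥ y = T.fac i ⬝ᵥ z) : y = z := by
  ext k
  have hy := T.expand (Pi.single k 1) y
  have hz := T.expand (Pi.single k 1) z
  simp only [h] at hy
  rw [← hz] at hy
  simpa using hy

lemma height_eq (T : SimplicialCone) (z : Fin 3 → ℤ) :
    (z 2 : ℚ) =
      ∑ j, ((T.fac j ⬝ᵥ z : ℤ) : ℚ) / ((T.fac j ⬝ᵥ T.gen j : ℤ) : ℚ) * (T.gen j 2 : ℚ) := by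
  simpa using T.expand (Pi.single 2 1) z

lemma fac_le (T : SimplicialCone) {z : Fin 3 → ℤ} (hz : ∀ i, 0 ≤ T.fac i ⬝ᵥ z) (i : Fin 3) :
    T.fac i ⬝ᵥ z ≤ z 2 * (T.fac i ⬝ᵥ T.gen i) := by
  have hd (j : Fin 3) : (0 : ℚ) < ((T.fac j ⬝ᵥ T.gen j : ℤ) : ℚ) := by exact_mod_cast T.pos j
  have hh (j : Fin 3) : (0 : ℚ) < (T.gen j 2 : ℚ) := by exact_mod_cast T.height_pos j
  have hz' (j : Fin 3) : (0 : ℚ) ≤ ((T.fac j ⬝ᵥ z : ℤ) : ℚ) := by exact_mod_cast hz j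
  have h1 : ((T.fac i ⬝ᵥ z : ℤ) : ℚ) / ((T.fac i ⬝ᵥ T.gen i : ℤ) : ℚ) * (T.gen i 2 : ℚ) ≤ z 2 := by
    rw [T.height_eq z]
    exact Finset.single_le_sum (f := fun j => ((T.fac j ⬝ᵥ z : ℤ) : ℚ) /
      ((T.fac j ⬝ᵥ T.gen j : ℤ) : ℚ) * (T.gen j 2 : ℚ))
      (fun j _ => mul_nonneg (div_nonneg (hz' j) (hd j).le) (hh j).le) (Finset.mem_univ i)
  have h2 : (1 : ℚ) ≤ (T.gen i 2 : ℚ) := by exact_mod_cast T.height_pos i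
  have h3 : ((T.fac i ⬝ᵥ z : ℤ) : ℚ) / ((T.fac i ⬝ᵥ T.gen i : ℤ) : ℚ) ≤ z 2 :=
    (le_mul_of_one_le_right (div_nonneg (hz' i) (hd i).le) h2).trans h1
  rw [div_le_iff₀ (hd i)] at h3
  exact_mod_cast h3

/-- A simplicial cone has finitely many lattice points at each height. -/
lemma finite_slice (T : SimplicialCone) (n : ℤ) :
    {z : Fin 3 → ℤ | z 2 = n ∧ ∀ i, 0 ≤ T.fac i ⬝ᵥ z}.Finite := by
  refine Set.Finite.of_finite_image (f := fun z i => T.fac i ⬝ᵥ z) ?_ ?_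
  · refine (Set.finite_Icc (0 : Fin 3 → ℤ) fun i => n * (T.fac i ⬝ᵥ T.gen i)).subset ?_
    rintro _ ⟨z, ⟨rfl, hz⟩, rfl⟩
    exact ⟨hz, fun i => T.fac_le hz i⟩
  · exact fun y _ z _ h => T.eq_of_forall_fac fun i => congrFun h i

/-- The part of a simplicial cone on the positive side of a plane that has one generator strictly
on this side and the two others on the other side is again a simplicial cone. -/
def cut (T : SimplicialCone) (l : Fin 3 → ℤ) (i : Fin 3) (hi : 0 < l ⬝ᵥ T.gen i)
    (hl : ∀ j, j ≠ i → l ⬝ᵥ T.gen j ≤ 0) : SimplicialCone where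
  gen := fun j => if j = i then T.gen i else
    (l ⬝ᵥ T.gen i) • T.gen j - (l ⬝ᵥ T.gen j) • T.gen i
  fac := Function.update T.fac i l
  orth := by
    intro j k hjk
    by_cases hj : j = i
    · subst hj
      rw [Function.update_self, if_neg hjk.symm, dotProduct_sub, dotProduct_smul, dotProduct_smul]
      simp only [smul_eq_mul]; ring
    · rw [Function.update_of_ne hj]
      by_cases hk : k = i
      · rw [if_pos hk]; exact T.orth j i hj
      · rw [if_neg hk, dotProduct_sub, dotProduct_smul, dotProduct_smul, T.orth j i hj,
          T.orth j k hjk]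
        simp
  pos := by
    intro j
    by_cases hj : j = i
    · subst hj; simpa using hi
    · rw [Function.update_of_ne hj, if_neg hj, dotProduct_sub, dotProduct_smul, dotProduct_smul,
        T.orth j i hj]
      simpa using mul_pos hi (T.pos j)
  height_pos := by
    intro j
    by_cases hj : j = i
    · rw [if_pos hj]; exact T.height_pos i
    · rw [if_neg hj]
      have h1 := mul_pos hi (T.height_pos j)
      have h2 := mul_nonneg (neg_nonneg.2 (hl j hj)) (T.height_pos i).le
      simp only [Pi.sub_apply, Pi.smul_apply, smul_eq_mul]
      linarith

lemma indicator_eq_ite (T : SimplicialCone) (z : Fin 3 → ℤ) :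
    T.indicator z = if ∀ i, 0 < T.fac i ⬝ᵥ z then 1 else 0 := by
  simp [indicator, halfSpace, Finset.prod_ite_zero]

lemma indicator_cut (T : SimplicialCone) (l : Fin 3 → ℤ) (i : Fin 3) (hi : 0 < l ⬝ᵥ T.gen i)
    (hl : ∀ j, j ≠ i → l ⬝ᵥ T.gen j ≤ 0) (z : Fin 3 → ℤ) :
    (T.cut l i hi hl).indicator z = halfSpace l z * T.indicator z := by
  have key : (∀ j, 0 < (T.cut l i hi hl).fac j ⬝ᵥ z) ↔ 0 < l ⬝ᵥ z ∧ ∀ j, 0 < T.fac j ⬝ᵥ z := by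
    constructor
    · intro h
      have h0 : 0 < l ⬝ᵥ z := by simpa [cut] using h i
      have h1 (j : Fin 3) (hj : j ≠ i) : 0 < T.fac j ⬝ᵥ z := by
        simpa [cut, Function.update_of_ne hj] using h j
      refine ⟨h0, fun j => ?_⟩
      by_cases hj : j = i
      · subst hj
        -- in the expansion of `l ⬝ᵥ z > 0` only the term of index `j` can be positive
        have h2 := T.expand l z
        rw [← Finset.add_sum_erase _ _ (Finset.mem_univ j)] at h2
        have h3 : ∑ k ∈ Finset.univ.erase j, ((T.fac k ⬝ᵥ z : ℤ) : ℚ) /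
            ((T.fac k ⬝ᵥ T.gen k : ℤ) : ℚ) * ((l ⬝ᵥ T.gen k : ℤ) : ℚ) ≤ 0 := by
          refine Finset.sum_nonpos fun k hk => mul_nonpos_of_nonneg_of_nonpos (div_nonneg ?_ ?_) ?_
          · exact_mod_cast (h1 k (Finset.ne_of_mem_erase hk)).le
          · exact_mod_cast (T.pos k).le
          · exact_mod_cast hl k (Finset.ne_of_mem_erase hk)
        have h4 : (0 : ℚ) < ((l ⬝ᵥ z : ℤ) : ℚ) := by exact_mod_cast h0
        have h5 : (0 : ℚ) < ((l ⬝ᵥ T.gen j : ℤ) : ℚ) := by exact_mod_cast hi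
        have h6 : (0 : ℚ) < ((T.fac j ⬝ᵥ T.gen j : ℤ) : ℚ) := by exact_mod_cast T.pos j
        have h7 : (0 : ℚ) < ((T.fac j ⬝ᵥ z : ℤ) : ℚ) := by
          by_contra hc
          have := mul_nonpos_of_nonpos_of_nonneg
            (div_nonpos_of_nonpos_of_nonneg (not_lt.1 hc) h6.le) h5.le
          linarith
        exact_mod_cast h7
      · exact h1 j hj
    · rintro ⟨h0, h⟩ j
      by_cases hj : j = i
      · subst hj; simpa [cut] using h0
      · simpa [cut, Function.update_of_ne hj] using h j
  rw [indicator_eq_ite, indicator_eq_ite, halfSpace]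
  simp only [key]
  by_cases h1 : 0 < l ⬝ᵥ z <;> simp [h1]

lemma indicator_eq_zero_of_nonpos (T : SimplicialCone) {l : Fin 3 → ℤ}
    (hl : ∀ j, l ⬝ᵥ T.gen j ≤ 0) (z : Fin 3 → ℤ) : halfSpace l z * T.indicator z = 0 := by
  rw [indicator_eq_ite]
  split_ifs with h
  · have : ((l ⬝ᵥ z : ℤ) : ℚ) ≤ 0 := by
      rw [T.expand l z]
      refine Finset.sum_nonpos fun k _ => mul_nonpos_of_nonneg_of_nonpos (div_nonneg ?_ ?_) ?_
      · exact_mod_cast (h k).le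
      · exact_mod_cast (T.pos k).le
      · exact_mod_cast hl k
    have : l ⬝ᵥ z ≤ 0 := by exact_mod_cast this
    simp [halfSpace, not_lt.2 this]
  · simp

end SimplicialCone

lemma halfSpace_neg {l z : Fin 3 → ℤ} (h : l ⬝ᵥ z ≠ 0) :
    halfSpace (-l) z = 1 - halfSpace l z := by
  simp only [halfSpace, neg_dotProduct]
  rcases lt_or_gt_of_ne h with h | h <;> simp [h, not_lt.2 h.le]

/-- The linear combinations of indicator functions of simplicial cones with facet normals in `L`. -/
def coneSpan (L : Set (Fin 3 → ℤ)) : Submodule ℤ ((Fin 3 → ℤ) → ℤ) :=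
  Submodule.span ℤ {f | ∃ T : SimplicialCone, (∀ i, T.fac i ∈ L) ∧ f = T.indicator}

/-- The functions that agree with a linear combination of indicator functions of simplicial cones
with facet normals in `L` off the planes with normals in `L`. -/
def IsConeCombination (L : Set (Fin 3 → ℤ)) (f : (Fin 3 → ℤ) → ℤ) : Prop :=
  ∃ g ∈ coneSpan L, ∀ z, (∀ l ∈ L, l ⬝ᵥ z ≠ 0) → f z = g z

namespace IsConeCombination

variable {L : Set (Fin 3 → ℤ)} {f g : (Fin 3 → ℤ) → ℤ}

lemma of_indicator (T : SimplicialCone) (hT : ∀ i, T.fac i ∈ L) :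
    IsConeCombination L T.indicator :=
  ⟨_, Submodule.subset_span ⟨T, hT, rfl⟩, fun _ _ => rfl⟩

lemma zero : IsConeCombination L 0 := ⟨0, zero_mem _, fun _ _ => rfl⟩

lemma add (hf : IsConeCombination L f) (hg : IsConeCombination L g) :
    IsConeCombination L (f + g) := by
  obtain ⟨f', hf', h1⟩ := hf
  obtain ⟨g', hg', h2⟩ := hg
  exact ⟨f' + g', add_mem hf' hg', fun z hz => by simp [h1 z hz, h2 z hz]⟩

lemma smul (a : ℤ) (hf : IsConeCombination L f) : IsConeCombination L (a • f) := by
  obtain ⟨f', hf', h1⟩ := hf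
  exact ⟨a • f', Submodule.smul_mem _ _ hf', fun z hz => by simp [h1 z hz]⟩

lemma sub (hf : IsConeCombination L f) (hg : IsConeCombination L g) :
    IsConeCombination L (f - g) := by
  have := hf.add (hg.smul (-1))
  rwa [neg_one_smul, ← sub_eq_add_neg] at this

lemma congr (hf : IsConeCombination L f) (h : ∀ z, (∀ l ∈ L, l ⬝ᵥ z ≠ 0) → g z = f z) :
    IsConeCombination L g := by
  obtain ⟨f', hf', h1⟩ := hf
  exact ⟨f', hf', fun z hz => (h z hz).trans (h1 z hz)⟩

lemma halfSpace_mul_indicator (hL : ∀ l ∈ L, -l ∈ L) {l : Fin 3 → ℤ} (hl : l ∈ L)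
    (T : SimplicialCone) (hT : ∀ i, T.fac i ∈ L) :
    IsConeCombination L (halfSpace l * T.indicator) := by
  have cutting (l : Fin 3 → ℤ) (hl : l ∈ L) (i : Fin 3) (hi : 0 < l ⬝ᵥ T.gen i)
      (hj : ∀ j, j ≠ i → l ⬝ᵥ T.gen j ≤ 0) : IsConeCombination L (halfSpace l * T.indicator) := by
    refine (of_indicator (T.cut l i hi hj) fun j => ?_).congr fun z _ =>
      (T.indicator_cut l i hi hj z).symm
    by_cases h : j = i
    · subst h; simpa [SimplicialCone.cut] using hl
    · simpa [SimplicialCone.cut, Function.update_of_ne h] using hT j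
  have nonpos (l : Fin 3 → ℤ) (hj : ∀ j, l ⬝ᵥ T.gen j ≤ 0) :
      IsConeCombination L (halfSpace l * T.indicator) :=
    zero.congr fun z _ => T.indicator_eq_zero_of_nonpos hj z
  have complement (h : IsConeCombination L (halfSpace (-l) * T.indicator)) :
      IsConeCombination L (halfSpace l * T.indicator) := by
    refine ((of_indicator T hT).sub h).congr fun z hz => ?_
    simp only [Pi.mul_apply, Pi.sub_apply, halfSpace_neg (hz l hl)]
    ring
  -- among three signs, at most one is positive or at most one is negative
  have cases : (∀ j, l ⬝ᵥ T.gen j ≤ 0) ∨ (∃ i, 0 < l ⬝ᵥ T.gen i ∧ ∀ j, j ≠ i → l ⬝ᵥ T.gen j ≤ 0) ∨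
      (∀ j, (-l) ⬝ᵥ T.gen j ≤ 0) ∨
      (∃ i, 0 < (-l) ⬝ᵥ T.gen i ∧ ∀ j, j ≠ i → (-l) ⬝ᵥ T.gen j ≤ 0) := by
    simp only [Fin.forall_fin_succ, Fin.exists_fin_succ, neg_dotProduct]
    simp
    grind
  rcases cases with h | ⟨i, hi, h⟩ | h | ⟨i, hi, h⟩
  · exact nonpos l h
  · exact cutting l hl i hi h
  · exact complement (nonpos _ h)
  · exact complement (cutting _ (hL l hl) i hi h)

lemma halfSpace_mul (hL : ∀ l ∈ L, -l ∈ L) {l : Fin 3 → ℤ} (hl : l ∈ L)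
    (hf : IsConeCombination L f) : IsConeCombination L (halfSpace l * f) := by
  obtain ⟨g, hg, hfg⟩ := hf
  suffices IsConeCombination L (halfSpace l * g) from
    this.congr fun z hz => by simp [hfg z hz]
  clear hfg
  induction hg using Submodule.span_induction with
  | mem g hg =>
    obtain ⟨T, hT, rfl⟩ := hg
    exact halfSpace_mul_indicator hL hl T hT
  | zero => rw [mul_zero]; exact zero
  | add g g' _ _ h h' => rw [mul_add]; exact h.add h'
  | smul a g _ h => rw [mul_smul_comm]; exact h.smul a

lemma indicator_mul (hL : ∀ l ∈ L, -l ∈ L) (T : SimplicialCone) (hT : ∀ i, T.fac i ∈ L)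
    (hf : IsConeCombination L f) : IsConeCombination L (T.indicator * f) := by
  refine (halfSpace_mul hL (hT 0) (halfSpace_mul hL (hT 1) (halfSpace_mul hL (hT 2) hf))).congr
    fun z _ => ?_
  simp only [SimplicialCone.indicator, Pi.mul_apply, Fin.prod_univ_three]
  ring

/-- The indicator function of a finite union of simplicial cones, by inclusion–exclusion. -/
lemma one_sub_prod (hL : ∀ l ∈ L, -l ∈ L) {ι : Type*} (s : Finset ι) (T : ι → SimplicialCone)
    (hT : ∀ k, ∀ i, (T k).fac i ∈ L) :
    IsConeCombination L (1 - ∏ k ∈ s, (1 - (T k).indicator)) := by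
  classical
  induction s using Finset.induction_on with
  | empty => simpa using zero
  | insert a s ha ih =>
    rw [Finset.prod_insert ha]
    have : 1 - (1 - (T a).indicator) * ∏ k ∈ s, (1 - (T k).indicator) =
        (1 - ∏ k ∈ s, (1 - (T k).indicator)) + ((T a).indicator -
          (T a).indicator * (1 - ∏ k ∈ s, (1 - (T k).indicator))) := by ring
    rw [this]
    exact ih.add ((of_indicator _ (hT a)).sub (indicator_mul hL _ (hT a) ih))

end IsConeCombination

/-! ### Lattice points of half-open cones, height by height -/

/-- All horizontal slices of `g` have finite support. -/
def HasFiniteSlices (g : (Fin 3 → ℤ) → ℤ) : Prop :=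
  ∀ n : ℤ, (Function.support fun x : ℤ × ℤ => g ![x.1, x.2, n]).Finite

/-- The sum of `g` over the lattice points of height `n`. -/
def sliceSum (g : (Fin 3 → ℤ) → ℤ) (n : ℤ) : ℚ :=
  ((∑ᶠ x : ℤ × ℤ, g ![x.1, x.2, n] : ℤ) : ℚ)

lemma HasFiniteSlices.add {g g' : (Fin 3 → ℤ) → ℤ} (h : HasFiniteSlices g)
    (h' : HasFiniteSlices g') : HasFiniteSlices (g + g') := fun n =>
  ((h n).union (h' n)).subset (Function.support_add _ _)

lemma HasFiniteSlices.smul {g : (Fin 3 → ℤ) → ℤ} (a : ℤ) (h : HasFiniteSlices g) :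
    HasFiniteSlices (a • g) := fun n =>
  (h n).subset fun x hx hx' => hx (by simp only [Pi.smul_apply, hx', smul_zero])

lemma sliceSum_add {g g' : (Fin 3 → ℤ) → ℤ} (h : HasFiniteSlices g)
    (h' : HasFiniteSlices g') : sliceSum (g + g') = sliceSum g + sliceSum g' := by
  ext n
  simp only [sliceSum, Pi.add_apply]
  rw [finsum_add_distrib (h n) (h' n)]
  push_cast; rfl

lemma sliceSum_smul {g : (Fin 3 → ℤ) → ℤ} (a : ℤ) (h : HasFiniteSlices g) :
    sliceSum (a • g) = (a : ℚ) • sliceSum g := by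
  ext n
  simp only [sliceSum, Pi.smul_apply]
  rw [← smul_finsum' a (h n), smul_eq_mul, smul_eq_mul]
  push_cast; rfl

lemma cons_sub_eq (x : ℤ × ℤ) (n : ℤ) (A : Fin 3 → ℤ) :
    ![x.1, x.2, n] - A = ![(x - (A 0, A 1)).1, (x - (A 0, A 1)).2, n - A 2] := by
  ext i; fin_cases i <;> simp

lemma HasFiniteSlices.comp_sub {g : (Fin 3 → ℤ) → ℤ} (h : HasFiniteSlices g) (A : Fin 3 → ℤ) :
    HasFiniteSlices fun v => g (v - A) := fun n => by
  simp only [cons_sub_eq]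
  exact (h (n - A 2)).preimage (sub_left_injective (b := (A 0, A 1))).injOn

lemma HasFiniteSlices.sub_comp_sub {g : (Fin 3 → ℤ) → ℤ} (h : HasFiniteSlices g)
    (A : Fin 3 → ℤ) : HasFiniteSlices fun v => g v - g (v - A) := by
  have := h.add ((h.comp_sub A).smul (-1))
  simpa [sub_eq_add_neg, Pi.add_def] using this

lemma sliceSum_sub_comp_sub {g : (Fin 3 → ℤ) → ℤ} (h : HasFiniteSlices g) (A : Fin 3 → ℤ)
    (n : ℤ) : sliceSum (fun v => g v - g (v - A)) n = sliceSum g n - sliceSum g (n - A 2) := by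
  have h1 : ∑ᶠ x : ℤ × ℤ, g (![x.1, x.2, n] - A) = ∑ᶠ x : ℤ × ℤ, g ![x.1, x.2, n - A 2] := by
    simp only [cons_sub_eq]
    exact finsum_comp_equiv (Equiv.subRight (A 0, A 1))
      (f := fun x : ℤ × ℤ => g ![x.1, x.2, n - A 2])
  simp only [sliceSum]
  rw [finsum_sub_distrib (h n) (h.comp_sub A n), h1]
  push_cast; rfl

lemma isQuasiPolynomial_sliceSum_of_sub {g : (Fin 3 → ℤ) → ℤ} (h : HasFiniteSlices g)
    {A : Fin 3 → ℤ} (hA : 0 < A 2)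
    (hq : IsQuasiPolynomial (sliceSum fun v => g v - g (v - A))) :
    IsQuasiPolynomial (sliceSum g) := by
  refine hq.of_sub_shift (h := (A 2).toNat) (by omega) fun n => ?_
  rw [sliceSum_sub_comp_sub h, Int.toNat_of_nonneg hA.le]

/-- The indicator function of the half-open half-space of all `v` such that `0 < l ⬝ᵥ (k • v + w)`
for all large `k`, that is, such that `v` moves into the half-space when it is displaced slightly in
direction `w`. -/
def germ (w l v : Fin 3 → ℤ) : ℤ :=
  if 0 < l ⬝ᵥ v ∨ (l ⬝ᵥ v = 0 ∧ 0 < l ⬝ᵥ w) then 1 else 0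

lemma germ_sub {w l A : Fin 3 → ℤ} (h : l ⬝ᵥ A = 0) (v : Fin 3 → ℤ) :
    germ w l (v - A) = germ w l v := by
  simp [germ, dotProduct_sub, h]

lemma germ_sub_sub {w l A : Fin 3 → ℤ} (h : l ⬝ᵥ A = 0) (v B : Fin 3 → ℤ) :
    germ w l (v - A - B) = germ w l (v - B) := by
  simp [germ, dotProduct_sub, h]

lemma eventually_halfSpace_eq_germ {w l : Fin 3 → ℤ} (hw : l ⬝ᵥ w ≠ 0) (v : Fin 3 → ℤ) :
    ∀ᶠ k : ℕ in atTop, halfSpace l ((k : ℤ) • v + w) = germ w l v ∧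
      halfSpace l (-((k : ℤ) • v + w)) = 1 - germ w l v := by
  filter_upwards [eventually_gt_atTop (l ⬝ᵥ w).natAbs] with k hk
  have hk' : |l ⬝ᵥ w| < k := by rw [Int.abs_eq_natAbs]; exact_mod_cast hk
  obtain ⟨hk1, hk2⟩ := abs_lt.1 hk'
  simp only [halfSpace, germ, dotProduct_neg, dotProduct_add, dotProduct_smul, smul_eq_mul]
  generalize l ⬝ᵥ w = b at *
  rcases lt_trichotomy (l ⬝ᵥ v) 0 with h | h | h
  · have h1 : (k : ℤ) * (l ⬝ᵥ v) + b < 0 := by nlinarith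
    have h2 : ¬ 0 < (k : ℤ) * (l ⬝ᵥ v) + b := by omega
    have h3 : 0 < -((k : ℤ) * (l ⬝ᵥ v) + b) := by omega
    rw [if_neg h2, if_pos h3, if_neg (by omega)]; simp
  · simp only [h, mul_zero, zero_add, lt_irrefl, false_or, true_and]
    split_ifs <;> omega
  · have h1 : 0 < (k : ℤ) * (l ⬝ᵥ v) + b := by nlinarith
    have h3 : ¬ 0 < -((k : ℤ) * (l ⬝ᵥ v) + b) := by omega
    rw [if_pos h1, if_neg h3, if_pos (Or.inl h)]; simp

namespace SimplicialCone

/-- The indicator function of a half-open simplicial cone, plus that of the reflection in the origin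
of the complementary half-open cone. -/
def doubleCone (T : SimplicialCone) (w v : Fin 3 → ℤ) : ℤ :=
  ∏ i, germ w (T.fac i) v + ∏ i, (1 - germ w (T.fac i) v)

lemma hasFiniteSlices_doubleCone (T : SimplicialCone) (w : Fin 3 → ℤ) :
    HasFiniteSlices (T.doubleCone w) := by
  intro n
  have hinj : Function.Injective fun x : ℤ × ℤ => (![x.1, x.2, n] : Fin 3 → ℤ) := by
    intro x y h
    have h0 := congrFun h 0
    have h1 := congrFun h 1
    exact Prod.ext h0 h1
  have hf := ((T.finite_slice n).union ((T.finite_slice (-n)).preimage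
    (neg_injective (G := Fin 3 → ℤ)).injOn)).preimage hinj.injOn
  refine hf.subset fun x hx => ?_
  rw [Function.mem_support, doubleCone] at hx
  have : ∏ i, germ w (T.fac i) ![x.1, x.2, n] ≠ 0 ∨
      ∏ i, (1 - germ w (T.fac i) ![x.1, x.2, n]) ≠ 0 := by
    by_contra! h
    exact hx (by rw [h.1, h.2, add_zero])
  rcases this with h | h
  · refine Or.inl ⟨by simp, fun i => ?_⟩
    have := Finset.prod_ne_zero_iff.1 h i (Finset.mem_univ i)
    contrapose! this
    exact if_neg (by omega)
  · refine Or.inr ⟨by simp, fun i => ?_⟩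
    have := Finset.prod_ne_zero_iff.1 h i (Finset.mem_univ i)
    contrapose! this
    rw [dotProduct_neg] at this
    rw [germ, if_pos (Or.inl (by omega)), sub_self]

lemma isQuasiPolynomial_doubleCone (T : SimplicialCone) (w : Fin 3 → ℤ) :
    IsQuasiPolynomial (sliceSum (T.doubleCone w)) := by
  have h := T.hasFiniteSlices_doubleCone w
  refine isQuasiPolynomial_sliceSum_of_sub h (T.height_pos 0) ?_
  have h := h.sub_comp_sub (T.gen 0)
  refine isQuasiPolynomial_sliceSum_of_sub h (T.height_pos 1) ?_
  have h := h.sub_comp_sub (T.gen 1)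
  refine isQuasiPolynomial_sliceSum_of_sub h (T.height_pos 2) ?_
  -- the three differences turn each product into plus or minus the indicator function of the
  -- half-open parallelepiped spanned by the generators
  convert isQuasiPolynomial_zero
  have o (i j : Fin 3) (hij : i ≠ j) := T.orth i j hij
  have h01 := o 0 1 (by decide)
  have h02 := o 0 2 (by decide)
  have h10 := o 1 0 (by decide)
  have h12 := o 1 2 (by decide)
  have h20 := o 2 0 (by decide)
  have h21 := o 2 1 (by decide)
  ext n
  rw [Pi.zero_apply, sliceSum]
  rw [Int.cast_eq_zero]
  refine finsum_eq_zero_of_forall_eq_zero fun x => ?_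
  simp only [doubleCone, Fin.prod_univ_three, germ_sub h01, germ_sub h02, germ_sub h10,
    germ_sub h12, germ_sub h20, germ_sub h21, germ_sub_sub h01, germ_sub_sub h02,
    germ_sub_sub h12]
  ring

end SimplicialCone

/-- Reciprocity for combinations of cones: the sum of `f` over displaced lattice points and over
their reflections is, height by height, one quasi-polynomial on all of `ℤ`. -/
lemma IsConeCombination.exists_isQuasiPolynomial {L : Set (Fin 3 → ℤ)} (hL : L.Finite)
    {f : (Fin 3 → ℤ) → ℤ} (hf : IsConeCombination L f) {w : Fin 3 → ℤ}
    (hw : ∀ l ∈ L, l ⬝ᵥ w ≠ 0) :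
    ∃ G : (Fin 3 → ℤ) → ℤ, HasFiniteSlices G ∧ IsQuasiPolynomial (sliceSum G) ∧
      ∀ v, ∀ᶠ k : ℕ in atTop, G v = f ((k : ℤ) • v + w) + f (-((k : ℤ) • v + w)) := by
  obtain ⟨g, hg, hfg⟩ := hf
  suffices ∃ G : (Fin 3 → ℤ) → ℤ, HasFiniteSlices G ∧ IsQuasiPolynomial (sliceSum G) ∧
      ∀ v, ∀ᶠ k : ℕ in atTop, G v = g ((k : ℤ) • v + w) + g (-((k : ℤ) • v + w)) by
    obtain ⟨G, h1, h2, h3⟩ := this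
    refine ⟨G, h1, h2, fun v => ?_⟩
    have hgen : ∀ᶠ k : ℕ in atTop, ∀ l ∈ L, l ⬝ᵥ ((k : ℤ) • v + w) ≠ 0 := by
      rw [eventually_all_finite hL]
      intro l hl
      filter_upwards [eventually_halfSpace_eq_germ (hw l hl) v] with k hk h0
      rw [halfSpace, halfSpace, dotProduct_neg, h0] at hk
      simp only [lt_irrefl, neg_zero, if_false] at hk
      omega
    filter_upwards [h3 v, hgen] with k hk hk'
    rw [hk, hfg _ hk', hfg _ fun l hl => by rw [dotProduct_neg]; exact neg_ne_zero.2 (hk' l hl)]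
  clear hfg
  induction hg using Submodule.span_induction with
  | mem g hg =>
    obtain ⟨T, hT, rfl⟩ := hg
    refine ⟨T.doubleCone w, T.hasFiniteSlices_doubleCone w, T.isQuasiPolynomial_doubleCone w,
      fun v => ?_⟩
    have := eventually_all.2 fun i => eventually_halfSpace_eq_germ (hw _ (hT i)) v
    filter_upwards [this] with k hk
    simp only [SimplicialCone.doubleCone, SimplicialCone.indicator, hk]
  | zero =>
    refine ⟨0, fun n => by simp, ?_, fun v => by simp⟩
    convert isQuasiPolynomial_zero
    ext n; simp [sliceSum]
  | add g g' _ _ h h' =>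
    obtain ⟨G, h1, h2, h3⟩ := h
    obtain ⟨G', h1', h2', h3'⟩ := h'
    refine ⟨G + G', h1.add h1', by rw [sliceSum_add h1 h1']; exact h2.add h2', fun v => ?_⟩
    filter_upwards [h3 v, h3' v] with k hk hk'
    simp only [Pi.add_apply, hk, hk']; ring
  | smul a g _ h =>
    obtain ⟨G, h1, h2, h3⟩ := h
    refine ⟨a • G, h1.smul a, by rw [sliceSum_smul a h1]; exact h2.smul _, fun v => ?_⟩
    filter_upwards [h3 v] with k hk
    simp only [Pi.smul_apply, hk, smul_eq_mul]; ring

/-! ### The cone over a rational polygon -/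

/-- A rational point as a point of the real plane. -/
def realPoint (q : ℚ × ℚ) : ℝ × ℝ := ((q.1 : ℝ), (q.2 : ℝ))

/-- Integral homogeneous coordinates of a rational point. -/
def homog (q : ℚ × ℚ) : Fin 3 → ℤ := ![q.1.num * q.2.den, q.2.num * q.1.den, q.1.den * q.2.den]

/-- The point of the plane with homogeneous coordinates `z`; of interest when `0 < z 2`. -/
def dehomog (z : Fin 3 → ℤ) : ℝ × ℝ := ((z 0 : ℝ) / z 2, (z 1 : ℝ) / z 2)

lemma homog_pos (q : ℚ × ℚ) : 0 < homog q 2 := by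
  simpa [homog] using mul_pos (Int.natCast_pos.2 q.1.den_pos) (Int.natCast_pos.2 q.2.den_pos)

lemma homog_cast (q : ℚ × ℚ) :
    (homog q 0 : ℝ) = homog q 2 * (q.1 : ℝ) ∧ (homog q 1 : ℝ) = homog q 2 * (q.2 : ℝ) := by
  have h1 : ((q.1.den : ℝ)) ≠ 0 := by exact_mod_cast q.1.den_pos.ne'
  have h2 : ((q.2.den : ℝ)) ≠ 0 := by exact_mod_cast q.2.den_pos.ne'
  have e1 : (q.1 : ℝ) = q.1.num / q.1.den := by exact_mod_cast (Rat.num_div_den q.1).symm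
  have e2 : (q.2 : ℝ) = q.2.num / q.2.den := by exact_mod_cast (Rat.num_div_den q.2).symm
  rw [e1, e2]
  constructor <;> · simp [homog]; field_simp

lemma dehomog_homog (q : ℚ × ℚ) : dehomog (homog q) = realPoint q := by
  have h : (homog q 2 : ℝ) ≠ 0 := by exact_mod_cast (homog_pos q).ne'
  rw [dehomog, (homog_cast q).1, (homog_cast q).2, mul_div_cancel_left₀ _ h,
    mul_div_cancel_left₀ _ h, realPoint]

lemma cross_homog_ne_zero {p q : ℚ × ℚ} (h : p ≠ q) : homog p ⨯₃ homog q ≠ 0 := by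
  intro h0
  have h1 := congrFun h0 0
  have h2 := congrFun h0 1
  have hp : (homog p 2 : ℝ) ≠ 0 := by exact_mod_cast (homog_pos p).ne'
  have hq : (homog q 2 : ℝ) ≠ 0 := by exact_mod_cast (homog_pos q).ne'
  simp only [cross_apply, Fin.isValue, cons_val_zero, cons_val_one, Pi.zero_apply] at h1 h2
  have h1' : (homog p 1 : ℝ) * homog q 2 - homog p 2 * homog q 1 = 0 := by exact_mod_cast h1
  have h2' : (homog p 2 : ℝ) * homog q 0 - homog p 0 * homog q 2 = 0 := by exact_mod_cast h2
  rw [(homog_cast p).2, (homog_cast q).2] at h1'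
  rw [(homog_cast p).1, (homog_cast q).1] at h2'
  have e1 : (homog p 2 : ℝ) * homog q 2 * ((p.2 : ℝ) - q.2) = 0 := by linear_combination h1'
  have e2 : (homog p 2 : ℝ) * homog q 2 * ((q.1 : ℝ) - p.1) = 0 := by linear_combination h2'
  have e1 := (mul_eq_zero.1 e1).resolve_left (mul_ne_zero hp hq)
  have e2 := (mul_eq_zero.1 e2).resolve_left (mul_ne_zero hp hq)
  refine h (Prod.ext ?_ ?_)
  · exact_mod_cast (sub_eq_zero.1 e2).symm
  · exact_mod_cast sub_eq_zero.1 e1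

/-- The normals of the planes spanned by the origin and the lines joining two points of `S`. -/
def joinNormals (S : Finset (ℚ × ℚ)) : Set (Fin 3 → ℤ) :=
  {l | ∃ p ∈ S, ∃ q ∈ S, p ≠ q ∧ l = homog p ⨯₃ homog q}

lemma finite_joinNormals (S : Finset (ℚ × ℚ)) : (joinNormals S).Finite := by
  refine ((S ×ˢ S).finite_toSet.image fun x => homog x.1 ⨯₃ homog x.2).subset ?_
  rintro _ ⟨p, hp, q, hq, -, rfl⟩
  exact ⟨(p, q), by simp [hp, hq], rfl⟩

lemma neg_mem_joinNormals {S : Finset (ℚ × ℚ)} : ∀ l ∈ joinNormals S, -l ∈ joinNormals S := by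
  rintro _ ⟨p, hp, q, hq, h, rfl⟩
  exact ⟨q, hq, p, hp, h.symm, cross_anticomm _ _⟩

lemma ne_zero_of_mem_joinNormals {S : Finset (ℚ × ℚ)} {l : Fin 3 → ℤ} (hl : l ∈ joinNormals S) :
    l ≠ 0 := by
  obtain ⟨p, -, q, -, h, rfl⟩ := hl
  exact cross_homog_ne_zero h

/-- The determinant of the homogeneous coordinates of three points; it is positive if they form a
counterclockwise triangle. -/
def orientation (a b c : ℚ × ℚ) : ℤ := (homog b ⨯₃ homog c) ⬝ᵥ homog a

lemma orientation_rotate (a b c : ℚ × ℚ) : orientation b c a = orientation a b c := by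
  simp only [orientation, cross_apply, dotProduct, Fin.sum_univ_three, cons_val_zero, cons_val_one,
    cons_val]
  ring

lemma orientation_swap (a b c : ℚ × ℚ) : orientation a c b = -orientation a b c := by
  simp only [orientation, cross_apply, dotProduct, Fin.sum_univ_three, cons_val_zero, cons_val_one,
    cons_val]
  ring

lemma orientation_self (a b : ℚ × ℚ) : orientation a b b = 0 := by
  simp [orientation]

/-- The cone over a counterclockwise rational triangle. -/
def triangleCone (a b c : ℚ × ℚ) (h : 0 < orientation a b c) : SimplicialCone where
  gen := ![homog a, homog b, homog c]
  fac := ![homog b ⨯₃ homog c, homog c ⨯₃ homog a, homog a ⨯₃ homog b]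
  orth := by
    intro i j hij
    fin_cases i <;> fin_cases j <;> first
      | exact absurd rfl hij
      | (simp only [Fin.zero_eta, Fin.mk_one, Fin.reduceFinMk, cons_val_zero, cons_val_one,
          cons_val, cross_apply, dotProduct, Fin.sum_univ_three]
         ring)
  pos := by
    intro i
    fin_cases i
    · exact h
    · exact lt_of_lt_of_eq h (orientation_rotate a b c).symm
    · exact lt_of_lt_of_eq h (orientation_rotate c a b)
  height_pos := by
    intro i
    fin_cases i
    · exact homog_pos a
    · exact homog_pos b
    · exact homog_pos c

lemma ne_of_orientation_ne_zero {a b c : ℚ × ℚ} (h : orientation a b c ≠ 0) : b ≠ c := by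
  rintro rfl
  exact h (orientation_self a b)

lemma triangleCone_fac_mem {S : Finset (ℚ × ℚ)} {a b c : ℚ × ℚ} (ha : a ∈ S) (hb : b ∈ S)
    (hc : c ∈ S) (h : 0 < orientation a b c) (i : Fin 3) :
    (triangleCone a b c h).fac i ∈ joinNormals S := by
  fin_cases i
  · exact ⟨b, hb, c, hc, ne_of_orientation_ne_zero h.ne', rfl⟩
  · refine ⟨c, hc, a, ha, ne_of_orientation_ne_zero (a := b) ?_, rfl⟩
    rw [orientation_rotate]; exact h.ne'
  · refine ⟨a, ha, b, hb, ne_of_orientation_ne_zero (a := c) ?_, rfl⟩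
    rw [← orientation_rotate]; exact h.ne'

/-- The indicator function of the cone over a planar set. -/
def coneOver (P : Set (ℝ × ℝ)) (z : Fin 3 → ℤ) : ℤ := by
  classical exact if 0 < z 2 ∧ dehomog z ∈ P then 1 else 0

/-- Carathéodory's theorem in the plane, for finite sets and with repetitions allowed. -/
lemma exists_three_of_mem_convexHull {S : Set (ℚ × ℚ)} {x : ℝ × ℝ}
    (hx : x ∈ convexHull ℝ (realPoint '' S)) :
    ∃ a ∈ S, ∃ b ∈ S, ∃ c ∈ S, ∃ α β γ : ℝ, 0 ≤ α ∧ 0 ≤ β ∧ 0 ≤ γ ∧ α + β + γ = 1 ∧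
      α • realPoint a + β • realPoint b + γ • realPoint c = x := by
  obtain ⟨ι, _, z, w, hz, hi, hw, hw1, hwx⟩ := eq_pos_convex_span_of_mem_convexHull hx
  have hcard : Fintype.card ι ≤ 3 := by
    refine hi.card_le_finrank_succ.trans ?_
    have := Submodule.finrank_le (vectorSpan ℝ (Set.range z))
    rw [Module.finrank_prod, Module.finrank_self] at this
    omega
  have hS (i : ι) : ∃ a ∈ S, realPoint a = z i := hz ⟨i, rfl⟩
  choose a ha haz using hS
  obtain ⟨k, hk⟩ : ∃ k, k = Fintype.card ι := ⟨_, rfl⟩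
  rw [← hk] at hcard
  let e : Fin k ≃ ι := (finCongr hk).trans (Fintype.equivFin ι).symm
  rw [← e.sum_comp] at hw1 hwx
  simp only [← haz] at hwx
  clear_value e
  clear hk
  interval_cases k
  · simp at hw1
  · rw [Fin.sum_univ_one] at hw1 hwx
    exact ⟨_, ha (e 0), _, ha (e 0), _, ha (e 0), w (e 0), 0, 0, (hw _).le, le_rfl, le_rfl,
      by simpa using hw1, by simpa using hwx⟩
  · rw [Fin.sum_univ_two] at hw1 hwx
    exact ⟨_, ha (e 0), _, ha (e 1), _, ha (e 1), w (e 0), w (e 1), 0, (hw _).le, (hw _).le, le_rfl,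
      by simpa using hw1, by simpa using hwx⟩
  · rw [Fin.sum_univ_three] at hw1 hwx
    exact ⟨_, ha (e 0), _, ha (e 1), _, ha (e 2), w (e 0), w (e 1), w (e 2), (hw _).le, (hw _).le,
      (hw _).le, hw1, hwx⟩

/-- A lattice point over a point of the triangle `abc`, in homogeneous coordinates. -/
lemma exists_homog_combination {z : Fin 3 → ℤ} (hz : 0 < z 2) {a b c : ℚ × ℚ} {α β γ : ℝ}
    (hα : 0 ≤ α) (hβ : 0 ≤ β) (hγ : 0 ≤ γ) (h1 : α + β + γ = 1)
    (hx : α • realPoint a + β • realPoint b + γ • realPoint c = dehomog z) :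
    ∃ α' β' γ' : ℝ, 0 ≤ α' ∧ 0 ≤ β' ∧ 0 ≤ γ' ∧
      ∀ i, (z i : ℝ) = α' * homog a i + β' * homog b i + γ' * homog c i := by
  have hz' : (0 : ℝ) < z 2 := by exact_mod_cast hz
  have ha : (0 : ℝ) < homog a 2 := by exact_mod_cast homog_pos a
  have hb : (0 : ℝ) < homog b 2 := by exact_mod_cast homog_pos b
  have hc : (0 : ℝ) < homog c 2 := by exact_mod_cast homog_pos c
  refine ⟨z 2 * α / homog a 2, z 2 * β / homog b 2, z 2 * γ / homog c 2, by positivity,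
    by positivity, by positivity, ?_⟩
  have e0 := congrArg Prod.fst hx
  have e1 := congrArg Prod.snd hx
  simp only [realPoint, dehomog, Prod.smul_mk, Prod.mk_add_mk, smul_eq_mul] at e0 e1
  rw [eq_div_iff hz'.ne'] at e0 e1
  intro i
  fin_cases i
  · change (z 0 : ℝ) = _ * (homog a 0 : ℝ) + _ * (homog b 0 : ℝ) + _ * (homog c 0 : ℝ)
    rw [(homog_cast a).1, (homog_cast b).1, (homog_cast c).1, ← e0]
    field_simp
  · change (z 1 : ℝ) = _ * (homog a 1 : ℝ) + _ * (homog b 1 : ℝ) + _ * (homog c 1 : ℝ)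
    rw [(homog_cast a).2, (homog_cast b).2, (homog_cast c).2, ← e1]
    field_simp
  · change (z 2 : ℝ) = _ * (homog a 2 : ℝ) + _ * (homog b 2 : ℝ) + _ * (homog c 2 : ℝ)
    field_simp
    exact h1.symm

lemma cross_dotProduct_combination {z A B C : Fin 3 → ℤ} {α β γ : ℝ}
    (h : ∀ i, (z i : ℝ) = α * A i + β * B i + γ * C i) :
    (((B ⨯₃ C) ⬝ᵥ z : ℤ) : ℝ) = α * (((B ⨯₃ C) ⬝ᵥ A : ℤ) : ℝ) := by
  simp only [cross_apply, dotProduct, Fin.sum_univ_three, cons_val_zero, cons_val_one, cons_val]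
  push_cast
  rw [h 0, h 1, h 2]
  ring

lemma indicator_triangleCone_eq_one {S : Finset (ℚ × ℚ)} {z : Fin 3 → ℤ}
    (hz : ∀ l ∈ joinNormals S, l ⬝ᵥ z ≠ 0) {a b c : ℚ × ℚ} (ha : a ∈ S) (hb : b ∈ S) (hc : c ∈ S)
    (h : 0 < orientation a b c) {α β γ : ℝ} (hα : 0 ≤ α) (hβ : 0 ≤ β) (hγ : 0 ≤ γ)
    (hx : ∀ i, (z i : ℝ) = α * homog a i + β * homog b i + γ * homog c i) :
    (triangleCone a b c h).indicator z = 1 := by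
  rw [SimplicialCone.indicator_eq_ite, if_pos]
  intro i
  refine lt_of_le_of_ne ?_ (hz _ (triangleCone_fac_mem ha hb hc h i)).symm
  have h0 : (0 : ℝ) < orientation a b c := by exact_mod_cast h
  have ea := cross_dotProduct_combination hx
  have eb := cross_dotProduct_combination (z := z) (A := homog b) (B := homog c) (C := homog a)
    (α := β) (β := γ) (γ := α) fun i => by rw [hx i]; ring
  have ec := cross_dotProduct_combination (z := z) (A := homog c) (B := homog a) (C := homog b)
    (α := γ) (β := α) (γ := β) fun i => by rw [hx i]; ring
  change _ = _ * (orientation _ _ _ : ℝ) at ea eb ec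
  rw [orientation_rotate] at eb
  rw [← orientation_rotate] at ec
  fin_cases i
  · have : (0 : ℝ) ≤ ((homog b ⨯₃ homog c ⬝ᵥ z : ℤ) : ℝ) := by rw [ea]; positivity
    exact_mod_cast this
  · have : (0 : ℝ) ≤ ((homog c ⨯₃ homog a ⬝ᵥ z : ℤ) : ℝ) := by rw [eb]; positivity
    exact_mod_cast this
  · have : (0 : ℝ) ≤ ((homog a ⨯₃ homog b ⬝ᵥ z : ℤ) : ℝ) := by rw [ec]; positivity
    exact_mod_cast this

/-- A lattice point over the convex hull of `S` that lies on no plane of the arrangement is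
interior to the cone over one of the triangles spanned by `S`. -/
lemma exists_triangleCone {S : Finset (ℚ × ℚ)} (hS : ∀ a ∈ S, ∃ b ∈ S, a ≠ b) {z : Fin 3 → ℤ}
    (hz : ∀ l ∈ joinNormals S, l ⬝ᵥ z ≠ 0) (hz2 : 0 < z 2)
    (hzP : dehomog z ∈ convexHull ℝ (realPoint '' (S : Set (ℚ × ℚ)))) :
    ∃ a ∈ S, ∃ b ∈ S, ∃ c ∈ S, ∃ h : 0 < orientation a b c,
      (triangleCone a b c h).indicator z = 1 := by
  obtain ⟨a, ha, b, hb, c, hc, α, β, γ, hα, hβ, hγ, h1, hx⟩ := exists_three_of_mem_convexHull hzP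
  obtain ⟨α, β, γ, hα, hβ, hγ, hx⟩ := exists_homog_combination hz2 hα hβ hγ h1 hx
  rcases lt_trichotomy (orientation a b c) 0 with h | h | h
  · refine ⟨a, ha, c, hc, b, hb, by rw [orientation_swap]; omega, ?_⟩
    exact indicator_triangleCone_eq_one hz ha hc hb _ hα hγ hβ fun i => by rw [hx i]; ring
  · -- three collinear points would put `z` on a plane of the arrangement
    exfalso
    have on_line {a b c : ℚ × ℚ} (hb : b ∈ S) (hc : c ∈ S) (hbc : b ≠ c)
        (h : orientation a b c = 0) {α β γ : ℝ}
        (hx : ∀ i, (z i : ℝ) = α * homog a i + β * homog b i + γ * homog c i) : False := by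
      have h0 := cross_dotProduct_combination hx
      change _ = _ * (orientation a b c : ℝ) at h0
      rw [h] at h0
      simp only [Int.cast_zero, mul_zero, Int.cast_eq_zero] at h0
      exact hz _ ⟨b, hb, c, hc, hbc, rfl⟩ h0
    by_cases hbc : b = c
    · subst hbc
      by_cases hab : a = b
      · subst hab
        obtain ⟨q, hq, haq⟩ := hS a ha
        exact on_line (a := a) (α := α + β + γ) (β := 0) (γ := 0) ha hq haq
          ((orientation_rotate q a a).trans (orientation_self q a))
          fun i => by rw [hx i]; ring
      · exact on_line (a := b) (α := β + γ) (β := α) (γ := 0) ha hb hab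
          ((orientation_rotate b b a).trans ((orientation_rotate a b b).trans h))
          fun i => by rw [hx i]; ring
    · exact on_line hb hc hbc h hx
  · exact ⟨a, ha, b, hb, c, hc, h, indicator_triangleCone_eq_one hz ha hb hc h hα hβ hγ hx⟩

lemma mem_of_indicator_triangleCone {a b c : ℚ × ℚ} (h : 0 < orientation a b c)
    {P : Set (ℝ × ℝ)} (hP : Convex ℝ P) (ha : realPoint a ∈ P) (hb : realPoint b ∈ P)
    (hc : realPoint c ∈ P) {z : Fin 3 → ℤ} (hz : (triangleCone a b c h).indicator z ≠ 0) :
    0 < z 2 ∧ dehomog z ∈ P := by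
  set T := triangleCone a b c h with hT
  rw [SimplicialCone.indicator_eq_ite] at hz
  have hpos : ∀ i, 0 < T.fac i ⬝ᵥ z := by
    by_contra h0
    exact hz (if_neg h0)
  set t : Fin 3 → ℝ := fun i => ((T.fac i ⬝ᵥ z : ℤ) : ℝ) / ((T.fac i ⬝ᵥ T.gen i : ℤ) : ℝ) with ht
  have ht0 (i : Fin 3) : 0 < t i :=
    div_pos (by exact_mod_cast hpos i) (by exact_mod_cast T.pos i)
  have hx (k : Fin 3) : (z k : ℝ) = t 0 * homog a k + t 1 * homog b k + t 2 * homog c k := by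
    have := T.expand (Pi.single k 1) z
    rw [Fin.sum_univ_three] at this
    simp only [single_one_dotProduct] at this
    have := congrArg (Rat.cast : ℚ → ℝ) this
    push_cast at this
    simpa [ht, hT, triangleCone] using this
  have hga : (0 : ℝ) < homog a 2 := by exact_mod_cast homog_pos a
  have hgb : (0 : ℝ) < homog b 2 := by exact_mod_cast homog_pos b
  have hgc : (0 : ℝ) < homog c 2 := by exact_mod_cast homog_pos c
  have h0 := ht0 0
  have h1 := ht0 1
  have h2 := ht0 2
  have hz2 : (0 : ℝ) < z 2 := by rw [hx 2]; positivity
  refine ⟨by exact_mod_cast hz2, ?_⟩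
  have hmem := hP.sum_mem (t := Finset.univ)
    (w := ![t 0 * homog a 2 / z 2, t 1 * homog b 2 / z 2, t 2 * homog c 2 / z 2])
    (z := ![realPoint a, realPoint b, realPoint c])
    (by intro i _; fin_cases i <;> simp <;> positivity)
    (by rw [Fin.sum_univ_three]
        simp only [cons_val_zero, cons_val_one, cons_val]
        rw [← add_div, ← add_div, ← hx 2, div_self hz2.ne'])
    (by intro i _; fin_cases i <;> simpa)
  convert hmem using 1
  rw [Fin.sum_univ_three]
  simp only [cons_val_zero, cons_val_one, cons_val, realPoint, dehomog, Prod.smul_mk,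
    Prod.mk_add_mk, smul_eq_mul]
  rw [hx 0, hx 1, (homog_cast a).1, (homog_cast b).1, (homog_cast c).1, (homog_cast a).2,
    (homog_cast b).2, (homog_cast c).2]
  ext <;> ring

/-- The indicator function of the cone over a rational polygon is, off finitely many planes, a
combination of indicator functions of simplicial cones. -/
lemma isConeCombination_coneOver {S : Finset (ℚ × ℚ)} (hS : ∀ a ∈ S, ∃ b ∈ S, a ≠ b) :
    IsConeCombination (joinNormals S)
      (coneOver (convexHull ℝ (realPoint '' (S : Set (ℚ × ℚ))))) := by
  classical
  let ι := {t : S × S × S // 0 < orientation t.1 t.2.1 t.2.2}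
  let T : ι → SimplicialCone := fun t => triangleCone t.1.1 t.1.2.1 t.1.2.2 t.2
  have hT (t : ι) (i : Fin 3) : (T t).fac i ∈ joinNormals S :=
    triangleCone_fac_mem t.1.1.2 t.1.2.1.2 t.1.2.2.2 t.2 i
  refine (IsConeCombination.one_sub_prod neg_mem_joinNormals Finset.univ T hT).congr
    fun z hz => ?_
  rw [Pi.sub_apply, Pi.one_apply, Finset.prod_apply, coneOver]
  simp only [Pi.sub_apply, Pi.one_apply]
  split_ifs with h
  · obtain ⟨a, ha, b, hb, c, hc, h', h1⟩ := exists_triangleCone hS hz h.1 h.2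
    rw [Finset.prod_eq_zero (Finset.mem_univ (⟨(⟨a, ha⟩, ⟨b, hb⟩, ⟨c, hc⟩), h'⟩ : ι)), sub_zero]
    exact sub_eq_zero.2 h1.symm
  · have h0 (t : ι) : (T t).indicator z = 0 := by
      by_contra h0
      have mem (a : S) : realPoint a ∈ convexHull ℝ (realPoint '' (S : Set (ℚ × ℚ))) :=
        subset_convexHull ℝ _ ⟨a, a.2, rfl⟩
      exact h (mem_of_indicator_triangleCone t.2 (convex_convexHull ℝ _) (mem _) (mem _) (mem _) h0)
    simp [h0]

/-! ### Generic displacements -/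

/-- A planar set with nonempty interior has a rational interior point off finitely many given lines;
both the point and the lines are in homogeneous coordinates. -/
lemma exists_generic_interior {P : Set (ℝ × ℝ)} (hP : (interior P).Nonempty)
    {L : Set (Fin 3 → ℤ)} (hL : L.Finite) (hL0 : ∀ l ∈ L, l ≠ 0) :
    ∃ w : Fin 3 → ℤ, 0 < w 2 ∧ dehomog w ∈ interior P ∧ ∀ l ∈ L, l ⬝ᵥ w ≠ 0 := by
  have hdense : DenseRange (Prod.map (Rat.cast : ℚ → ℝ) (Rat.cast : ℚ → ℝ)) :=
    Rat.denseRange_cast.prodMap Rat.denseRange_cast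
  obtain ⟨q, hq⟩ := hdense.exists_mem_open isOpen_interior hP
  change realPoint q ∈ interior P at hq
  rw [← dehomog_homog] at hq
  have hW := homog_pos q
  generalize homog q = W at hq hW
  -- a moment curve through the point meets every line only finitely often
  let w : ℕ → Fin 3 → ℤ := fun k =>
    ![(k : ℤ) ^ 2 * W 0 + k * W 2, (k : ℤ) ^ 2 * W 1 + W 2, (k : ℤ) ^ 2 * W 2]
  have hWr : (W 2 : ℝ) ≠ 0 := by exact_mod_cast hW.ne'
  have hlim : Tendsto (fun k => dehomog (w k)) atTop (𝓝 (dehomog W)) := by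
    have h1 : Tendsto (fun k : ℕ => ((k : ℝ))⁻¹) atTop (𝓝 0) := tendsto_inv_atTop_nhds_zero_nat
    have h2 : Tendsto
        (fun k : ℕ => ((W 0 : ℝ) / W 2 + (k : ℝ)⁻¹, (W 1 : ℝ) / W 2 + ((k : ℝ)⁻¹) ^ 2))
        atTop (𝓝 ((W 0 : ℝ) / W 2 + 0, (W 1 : ℝ) / W 2 + 0 ^ 2)) :=
      (tendsto_const_nhds.add h1).prodMk_nhds (tendsto_const_nhds.add (h1.pow 2))
    simp only [add_zero, ne_eq, OfNat.ofNat_ne_zero, not_false_eq_true, zero_pow] at h2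
    refine h2.congr' ?_
    filter_upwards [eventually_gt_atTop 0] with k hk
    have hk' : (k : ℝ) ≠ 0 := by exact_mod_cast hk.ne'
    simp only [dehomog, w, cons_val_zero, cons_val_one, cons_val]
    push_cast
    ext <;> · simp only []; field_simp
  have hint : ∀ᶠ k in atTop, dehomog (w k) ∈ interior P :=
    hlim.eventually (isOpen_interior.mem_nhds hq)
  have hgen : ∀ᶠ k in atTop, ∀ l ∈ L, l ⬝ᵥ w k ≠ 0 := by
    rw [eventually_all_finite hL]
    intro l hl
    set p : ℤ[X] := C (l ⬝ᵥ W) * X ^ 2 + C (l 0 * W 2) * X + C (l 1 * W 2) with hp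
    have hp0 : p ≠ 0 := by
      intro h0
      refine hL0 l hl ?_
      have c0 := congrArg (coeff · 0) h0
      have c1 := congrArg (coeff · 1) h0
      have c2 := congrArg (coeff · 2) h0
      simp [hp, coeff_X, coeff_C, -map_mul, -eq_intCast] at c0 c1 c2
      have e0 := c1.resolve_right hW.ne'
      have e1 := c0.resolve_right hW.ne'
      simp only [dotProduct, Fin.sum_univ_three, e0, e1, zero_mul, zero_add] at c2
      have e2 := (mul_eq_zero.1 c2).resolve_right hW.ne'
      ext i; fin_cases i <;> assumption
    have hroots : ∀ᶠ k : ℕ in atTop, ¬ p.IsRoot (k : ℤ) := by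
      rw [← Nat.cofinite_eq_atTop]
      exact (p.finite_setOfPred_isRoot hp0).preimage (Nat.cast_injective (R := ℤ)).injOn
        |>.eventually_cofinite_notMem
    filter_upwards [hroots] with k hk h0
    refine hk ?_
    rw [IsRoot, hp, ← h0]
    simp [w, dotProduct, Fin.sum_univ_three]
    ring
  obtain ⟨k, h1, h2, h3⟩ := (hint.and (hgen.and (eventually_gt_atTop 0))).exists
  have h4 : (0 : ℤ) < k := by exact_mod_cast h3
  exact ⟨w k, by simp only [w, cons_val]; positivity, h1, h2⟩

section Displacement

variable {P : Set (ℝ × ℝ)} {v w : Fin 3 → ℤ}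

lemma tendsto_dehomog (hv : 0 < v 2) (w : Fin 3 → ℤ) :
    Tendsto (fun k : ℕ => dehomog ((k : ℤ) • v + w)) atTop (𝓝 (dehomog v)) := by
  have hv' : (v 2 : ℝ) ≠ 0 := by exact_mod_cast hv.ne'
  have h1 : Tendsto (fun k : ℕ => ((k : ℝ))⁻¹) atTop (𝓝 0) := tendsto_inv_atTop_nhds_zero_nat
  have h2 (i : Fin 3) : Tendsto (fun k : ℕ => (v i : ℝ) + (k : ℝ)⁻¹ * w i) atTop (𝓝 (v i)) := by
    simpa using tendsto_const_nhds.add (h1.mul_const (w i : ℝ))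
  have h3 := ((h2 0).div (h2 2) hv').prodMk_nhds ((h2 1).div (h2 2) hv')
  refine h3.congr' ?_
  filter_upwards [eventually_gt_atTop 0] with k hk
  have hk' : (k : ℝ) ≠ 0 := by exact_mod_cast hk.ne'
  have e (i : Fin 3) : (v i : ℝ) + (k : ℝ)⁻¹ * w i = (k : ℝ)⁻¹ * (k * v i + w i) := by
    field_simp
  simp only [dehomog, Pi.div_apply, e, Pi.add_apply, Pi.smul_apply, smul_eq_mul]
  push_cast
  rw [mul_div_mul_left _ _ (inv_ne_zero hk'), mul_div_mul_left _ _ (inv_ne_zero hk')]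

lemma eventually_height_pos (hv : 0 < v 2) (w : Fin 3 → ℤ) :
    ∀ᶠ k : ℕ in atTop, 0 < ((k : ℤ) • v + w) 2 := by
  filter_upwards [eventually_gt_atTop (w 2).natAbs] with k hk
  have hk' : |w 2| < k := by rw [Int.abs_eq_natAbs]; exact_mod_cast hk
  have := (abs_lt.1 hk').1
  simp only [Pi.add_apply, Pi.smul_apply, smul_eq_mul]
  nlinarith

/-- The point over a sum of homogeneous vectors is a convex combination of the two points. -/
lemma dehomog_add (hv : 0 < v 2) (hw : 0 < w 2) :
    dehomog (v + w) =
      ((v 2 : ℝ) / (v 2 + w 2)) • dehomog v + ((w 2 : ℝ) / (v 2 + w 2)) • dehomog w := by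
  have hv' : (0 : ℝ) < v 2 := by exact_mod_cast hv
  have hw' : (0 : ℝ) < w 2 := by exact_mod_cast hw
  simp only [dehomog, Prod.smul_mk, Prod.mk_add_mk, smul_eq_mul, Pi.add_apply]
  push_cast
  ext <;> · simp only []; field_simp

lemma dehomog_add_mem_interior (hP : Convex ℝ P) (hv : 0 < v 2) (hw : 0 < w 2)
    (hvP : dehomog v ∈ P) (hwP : dehomog w ∈ interior P) : dehomog (v + w) ∈ interior P := by
  have hv' : (0 : ℝ) < v 2 := by exact_mod_cast hv
  have hw' : (0 : ℝ) < w 2 := by exact_mod_cast hw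
  rw [dehomog_add hv hw]
  exact hP.combo_self_interior_mem_interior hvP hwP (by positivity) (by positivity)
    (by field_simp)

lemma dehomog_natCast_smul {k : ℕ} (hk : 0 < k) (v : Fin 3 → ℤ) :
    dehomog ((k : ℤ) • v) = dehomog v := by
  have hk' : (k : ℝ) ≠ 0 := by exact_mod_cast hk.ne'
  simp only [dehomog, Pi.smul_apply, smul_eq_mul]
  push_cast
  rw [mul_div_mul_left _ _ hk', mul_div_mul_left _ _ hk']

/-- A point displaced slightly towards an interior point lies in `P` precisely when it did before
the displacement. -/
lemma eventually_coneOver_add (hP : Convex ℝ P) (hPc : IsClosed P) (hw : 0 < w 2)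
    (hwP : dehomog w ∈ interior P) (hv : 0 < v 2) :
    ∀ᶠ k : ℕ in atTop, coneOver P ((k : ℤ) • v + w) = coneOver P v := by
  by_cases hvP : dehomog v ∈ P
  · filter_upwards [eventually_gt_atTop 0] with k hk
    have hk' : (0 : ℤ) < k := by exact_mod_cast hk
    have hkv : 0 < ((k : ℤ) • v) 2 := mul_pos hk' hv
    rw [coneOver, coneOver, if_pos ⟨add_pos hkv hw, interior_subset
      (dehomog_add_mem_interior hP hkv hw (by rwa [dehomog_natCast_smul hk]) hwP)⟩,
      if_pos ⟨hv, hvP⟩]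
  · filter_upwards [(tendsto_dehomog hv w).eventually (hPc.isOpen_compl.mem_nhds hvP)] with k hk
    rw [coneOver, coneOver, if_neg fun h => hk h.2, if_neg fun h => hvP h.2]

/-- A point displaced slightly away from an interior point lies in `P` precisely when it was an
interior point before the displacement. -/
lemma eventually_coneOver_sub (hP : Convex ℝ P) (hw : 0 < w 2)
    (hwP : dehomog w ∈ interior P) (hv : 0 < v 2) :
    ∀ᶠ k : ℕ in atTop, coneOver P ((k : ℤ) • v - w) = coneOver (interior P) v := by
  have hpos := eventually_height_pos hv (-w)
  simp only [← sub_eq_add_neg] at hpos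
  by_cases hvP : dehomog v ∈ interior P
  · have hlim := (tendsto_dehomog hv (-w)).eventually (isOpen_interior.mem_nhds hvP)
    simp only [← sub_eq_add_neg] at hlim
    filter_upwards [hlim, hpos] with k hk hk'
    rw [coneOver, coneOver, if_pos ⟨hk', interior_subset hk⟩, if_pos ⟨hv, hvP⟩]
  · filter_upwards [hpos, eventually_gt_atTop 0] with k hk hk0
    rw [coneOver, coneOver, if_neg fun h => ?_, if_neg fun h => hvP h.2]
    have := dehomog_add_mem_interior hP hk hw h.2 hwP
    rw [sub_add_cancel, dehomog_natCast_smul hk0] at this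
    exact hvP this

lemma coneOver_of_height_nonpos (hv : v 2 ≤ 0) : coneOver P v = 0 :=
  if_neg fun h => by omega

lemma eventually_coneOver_of_height_neg (hv : v 2 < 0) (w : Fin 3 → ℤ) :
    ∀ᶠ k : ℕ in atTop, coneOver P ((k : ℤ) • v + w) = 0 := by
  filter_upwards [eventually_height_pos (v := -v) (by simpa using hv) (-w)] with k hk
  apply coneOver_of_height_nonpos
  simp only [Pi.add_apply, Pi.smul_apply, Pi.neg_apply, smul_eq_mul] at hk ⊢
  linarith

/-- A bounded set contains no ray. -/
lemma eventually_coneOver_of_height_zero (hP : Bornology.IsBounded P) (hw : 0 < w 2)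
    (hv : v 2 = 0) (hv0 : v ≠ 0) :
    ∀ᶠ k : ℕ in atTop, coneOver P ((k : ℤ) • v + w) = 0 := by
  obtain ⟨R, hR⟩ := hP.exists_norm_le
  have hw' : (0 : ℝ) < w 2 := by exact_mod_cast hw
  have key (i : Fin 3) (hi : v i ≠ 0) :
      ∀ᶠ k : ℕ in atTop, R < |((k : ℝ) * v i + w i) / w 2| := by
    have h1 : (1 : ℝ) ≤ |(v i : ℝ)| := by exact_mod_cast Int.one_le_abs hi
    filter_upwards [tendsto_natCast_atTop_atTop.eventually_gt_atTop (R * w 2 + |(w i : ℝ)|)]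
      with k hk
    rw [abs_div, abs_of_pos hw', lt_div_iff₀ hw']
    have h2 : |(k : ℝ) * v i| - |(w i : ℝ)| ≤ |(k : ℝ) * v i + w i| := by
      simpa using abs_sub_abs_le_abs_sub ((k : ℝ) * v i) (-w i : ℝ)
    rw [abs_mul, Nat.abs_cast] at h2
    have h3 : (k : ℝ) ≤ k * |(v i : ℝ)| := le_mul_of_one_le_right (Nat.cast_nonneg k) h1
    linarith
  have hex : ∃ i : Fin 3, i ≠ 2 ∧ v i ≠ 0 := by
    by_contra! h
    refine hv0 (funext fun i => ?_)
    by_cases hi : i = 2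
    · rw [hi, hv]; rfl
    · exact h i hi
  obtain ⟨i, hi2, hi⟩ := hex
  filter_upwards [key i hi] with k hk
  refine if_neg fun h => ?_
  have h1 := hR _ h.2
  rw [Prod.norm_def, max_le_iff] at h1
  simp only [dehomog, Pi.add_apply, Pi.smul_apply, smul_eq_mul, hv, mul_zero, zero_add,
    Real.norm_eq_abs] at h1
  push_cast at h1
  fin_cases i
  · exact absurd h1.1 (not_le.2 hk)
  · exact absurd h1.2 (not_le.2 hk)
  · exact hi2 rfl

end Displacement

/-! ### Reciprocity and Pick's theorem -/

/-- The lattice points of the `n`-th dilate, in homogeneous coordinates. -/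
def dilateLatticePoints (P : Set (ℝ × ℝ)) (n : ℕ) : Set (ℤ × ℤ) :=
  {x | dehomog ![x.1, x.2, n] ∈ P}

lemma latticePointEnumerator_eq_ncard (P : Set (ℝ × ℝ)) {n : ℕ} (hn : 0 < n) :
    latticePointEnumerator P n = (dilateLatticePoints P n).ncard := by
  have hn' : (n : ℝ) ≠ 0 := by exact_mod_cast hn.ne'
  have hinj : Function.Injective fun z : ℤ × ℤ => ((z.1 : ℝ), (z.2 : ℝ)) := by
    intro x y h
    simp only [Prod.mk.injEq, Int.cast_inj] at h
    exact Prod.ext h.1 h.2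
  rw [latticePointEnumerator, ← Set.ncard_image_of_injective _ hinj]
  congr 1
  ext p
  simp only [Set.mem_inter_iff, integerLattice, Set.mem_range, Set.mem_image]
  constructor
  · rintro ⟨h, x, rfl⟩
    refine ⟨x, ?_, rfl⟩
    rw [Set.mem_smul_set_iff_inv_smul_mem₀ hn'] at h
    simpa [dilateLatticePoints, dehomog, div_eq_inv_mul] using h
  · rintro ⟨x, hx, rfl⟩
    refine ⟨?_, x, rfl⟩
    rw [Set.mem_smul_set_iff_inv_smul_mem₀ hn']
    simpa [dilateLatticePoints, dehomog, div_eq_inv_mul] using hx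

lemma latticePointEnumerator_one (P : Set (ℝ × ℝ)) :
    latticePointEnumerator P 1 = (P ∩ integerLattice).ncard := by
  simp [latticePointEnumerator]

lemma finsum_coneOver (P : Set (ℝ × ℝ)) {n : ℕ} (hn : 0 < n) :
    ∑ᶠ x : ℤ × ℤ, coneOver P ![x.1, x.2, n] = latticePointEnumerator P n := by
  classical
  rw [latticePointEnumerator_eq_ncard P hn]
  have h (x : ℤ × ℤ) : coneOver P ![x.1, x.2, (n : ℤ)] =
      ∑ᶠ (_ : x ∈ dilateLatticePoints P n), (1 : ℤ) := by
    have hn' : 0 < (![x.1, x.2, (n : ℤ)] : Fin 3 → ℤ) 2 := by simpa using hn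
    rw [finsum_eq_if, coneOver]
    exact if_congr (and_iff_right hn') rfl rfl
  simp_rw [h]
  have := finsum_one (s := dilateLatticePoints P n)
  rw [← this]
  by_cases hfin : (dilateLatticePoints P n).Finite
  · rw [Nat.cast_finsum_mem hfin]; simp
  · have hinf {M : Type} [AddCommMonoid M] (a : M) :
        ∑ᶠ _i ∈ dilateLatticePoints P n, a = 0 := by
      rcases eq_or_ne a 0 with rfl | ha
      · simp
      · apply finsum_mem_eq_zero_of_infinite
        rwa [Function.support_const ha, Set.inter_univ]
    rw [hinf, hinf, Nat.cast_zero]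

lemma finite_dilateLatticePoints {P : Set (ℝ × ℝ)} (hP : Bornology.IsBounded P) {n : ℕ}
    (hn : 0 < n) : (dilateLatticePoints P n).Finite := by
  obtain ⟨R, hR⟩ := hP.exists_norm_le
  have hn' : (0 : ℝ) < n := by exact_mod_cast hn
  refine ((Set.finite_Icc (-⌈R * n⌉) ⌈R * n⌉).prod (Set.finite_Icc (-⌈R * n⌉) ⌈R * n⌉)).subset ?_
  intro x hx
  have h := hR _ hx
  have key (m : ℤ) (hm : |(m : ℝ) / n| ≤ R) : m ∈ Set.Icc (-⌈R * n⌉) ⌈R * n⌉ := by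
    rw [abs_div, abs_of_pos hn', div_le_iff₀ hn'] at hm
    have h1 := hm.trans (Int.le_ceil _)
    exact abs_le.1 (by exact_mod_cast h1)
  rw [Prod.norm_def, max_le_iff] at h
  simp only [dehomog, cons_val_zero, cons_val_one, cons_val, Real.norm_eq_abs] at h
  exact ⟨key _ (by exact_mod_cast h.1), key _ (by exact_mod_cast h.2)⟩

lemma interior_nonempty_of_not_collinear {S : Finset (ℚ × ℚ)}
    (hS : ¬ Collinear ℝ (realPoint '' (S : Set (ℚ × ℚ)))) :
    (interior (convexHull ℝ (realPoint '' (S : Set (ℚ × ℚ))))).Nonempty := by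
  rw [interior_convexHull_nonempty_iff_affineSpan_eq_top]
  have hne : (realPoint '' (S : Set (ℚ × ℚ))).Nonempty := by
    by_contra h
    rw [Set.not_nonempty_iff_eq_empty] at h
    exact hS (h ▸ collinear_empty ℝ _)
  rw [← AffineSubspace.direction_eq_top_iff_of_nonempty
    ((affineSpan_nonempty (k := ℝ)).2 hne), direction_affineSpan]
  rw [collinear_iff_finrank_le_one, not_le] at hS
  apply Submodule.eq_top_of_finrank_eq
  refine le_antisymm (Submodule.finrank_le _) ?_
  rw [Module.finrank_prod, Module.finrank_self]
  exact hS

lemma exists_ne_of_not_collinear {S : Finset (ℚ × ℚ)}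
    (hS : ¬ Collinear ℝ (realPoint '' (S : Set (ℚ × ℚ)))) : ∀ a ∈ S, ∃ b ∈ S, a ≠ b := by
  intro a _
  by_contra! h
  refine hS ((collinear_singleton ℝ (realPoint a)).subset ?_)
  rintro _ ⟨b, hb, rfl⟩
  rw [← h b hb]; rfl

/-- Ehrhart–Macdonald reciprocity for rational polygons. -/
theorem exists_isQuasiPolynomial_reciprocity {S : Finset (ℚ × ℚ)}
    (hS : ¬ Collinear ℝ (realPoint '' (S : Set (ℚ × ℚ)))) :
    ∃ E : ℤ → ℚ, IsQuasiPolynomial E ∧ E 0 = 1 ∧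
      (∀ n : ℕ, 0 < n → E n =
        latticePointEnumerator (convexHull ℝ (realPoint '' (S : Set (ℚ × ℚ)))) n) ∧
      (∀ n : ℕ, 0 < n → E (-n) =
        latticePointEnumerator (interior (convexHull ℝ (realPoint '' (S : Set (ℚ × ℚ))))) n) := by
  have hfin : (realPoint '' (S : Set (ℚ × ℚ))).Finite := S.finite_toSet.image _
  have hcomb := isConeCombination_coneOver (exists_ne_of_not_collinear hS)
  have hint := interior_nonempty_of_not_collinear hS
  have hconv := convex_convexHull ℝ (realPoint '' (S : Set (ℚ × ℚ)))
  have hcomp := hfin.isCompact_convexHull ℝ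
  generalize convexHull ℝ (realPoint '' (S : Set (ℚ × ℚ))) = P at *
  obtain ⟨w, hw, hwP, hwL⟩ := exists_generic_interior hint (finite_joinNormals S)
    fun l hl => ne_zero_of_mem_joinNormals hl
  obtain ⟨G, -, hG, hGv⟩ := hcomb.exists_isQuasiPolynomial (finite_joinNormals S) hwL
  have height_pos (v : Fin 3 → ℤ) (hv : 0 < v 2) : G v = coneOver P v := by
    have h1 := eventually_coneOver_add hconv hcomp.isClosed hw hwP hv
    have h2 := eventually_coneOver_of_height_neg (P := P) (v := -v) (by simpa using hv) (-w)
    obtain ⟨k, h, h1, h2⟩ := ((hGv v).and (h1.and h2)).exists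
    rw [smul_neg, ← neg_add] at h2
    rw [h, h1, h2, add_zero]
  have height_neg (v : Fin 3 → ℤ) (hv : v 2 < 0) : G v = coneOver (interior P) (-v) := by
    have h1 := eventually_coneOver_of_height_neg (P := P) hv w
    have h2 := eventually_coneOver_sub hconv hw hwP (v := -v) (by simpa using hv)
    obtain ⟨k, h, h1, h2⟩ := ((hGv v).and (h1.and h2)).exists
    rw [smul_neg, sub_eq_add_neg, ← neg_add] at h2
    rw [h, h1, h2, zero_add]
  have height_zero (v : Fin 3 → ℤ) (hv : v 2 = 0) (hv0 : v ≠ 0) : G v = 0 := by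
    have h1 := eventually_coneOver_of_height_zero hcomp.isBounded hw hv hv0
    obtain ⟨k, h, h1⟩ := ((hGv v).and h1).exists
    rw [h, h1, zero_add]
    apply coneOver_of_height_nonpos
    simp [hv, hw.le]
  have origin : G 0 = 1 := by
    obtain ⟨k, h⟩ := (hGv 0).exists
    rw [h, smul_zero, zero_add, coneOver_of_height_nonpos (v := -w) (by simpa using hw.le),
      add_zero]
    exact if_pos ⟨hw, interior_subset hwP⟩
  refine ⟨sliceSum G, hG, ?_, fun n hn => ?_, fun n hn => ?_⟩
  · rw [sliceSum, finsum_eq_single _ (0 : ℤ × ℤ)]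
    · have : (![(0 : ℤ × ℤ).1, (0 : ℤ × ℤ).2, 0] : Fin 3 → ℤ) = 0 := by
        ext i; fin_cases i <;> rfl
      rw [this, origin, Int.cast_one]
    · intro x hx
      refine height_zero _ rfl fun h => hx ?_
      exact Prod.ext (congrFun h 0) (congrFun h 1)
  · rw [sliceSum, finsum_congr fun x => height_pos _ (by simpa using hn), finsum_coneOver P hn,
      Int.cast_natCast]
  · have h1 (x : ℤ × ℤ) : G ![x.1, x.2, -n] = coneOver (interior P) ![(-x).1, (-x).2, n] := by
      rw [height_neg _ (by simpa using hn)]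
      congr 1
      ext i; fin_cases i <;> simp
    rw [sliceSum, finsum_congr h1]
    have h2 := finsum_comp_equiv (Equiv.neg (ℤ × ℤ))
      (f := fun x => coneOver (interior P) ![x.1, x.2, (n : ℤ)])
    simp only [Equiv.neg_apply] at h2
    rw [h2, finsum_coneOver _ hn, Int.cast_natCast]

/-- Some dilate of a rational polygon has a vertex, hence a boundary point, in the lattice. -/
lemma exists_dilateLatticePoints_ne {S : Finset (ℚ × ℚ)}
    (hS : ¬ Collinear ℝ (realPoint '' (S : Set (ℚ × ℚ)))) :
    ∃ n : ℕ, 0 < n ∧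
      dilateLatticePoints (interior (convexHull ℝ (realPoint '' (S : Set (ℚ × ℚ))))) n ≠
      dilateLatticePoints (convexHull ℝ (realPoint '' (S : Set (ℚ × ℚ)))) n := by
  have hne : S.Nonempty := by
    by_contra h
    rw [Finset.not_nonempty_iff_eq_empty] at h
    exact hS (by simpa [h] using collinear_empty ℝ _)
  obtain ⟨s, hs, hmax⟩ := S.exists_max_image Prod.fst hne
  set P := convexHull ℝ (realPoint '' (S : Set (ℚ × ℚ)))
  have hsP : realPoint s ∈ P := subset_convexHull ℝ _ ⟨s, hs, rfl⟩
  have hle : ∀ p ∈ P, p.1 ≤ s.1 := by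
    have : P ⊆ {p : ℝ × ℝ | LinearMap.fst ℝ ℝ ℝ p ≤ (s.1 : ℝ)} := by
      refine convexHull_min ?_ (convex_halfSpace_le (LinearMap.fst ℝ ℝ ℝ).isLinear (s.1 : ℝ))
      rintro _ ⟨q, hq, rfl⟩
      exact Rat.cast_le (K := ℝ).2 (hmax q hq)
    exact this
  have hnot : realPoint s ∉ interior P := by
    intro h
    have hlim : Tendsto (fun t : ℝ => realPoint s + (t, 0)) (𝓝[>] 0) (𝓝 (realPoint s)) := by
      have : Tendsto (fun t : ℝ => realPoint s + (t, 0)) (𝓝 0) (𝓝 (realPoint s + (0, 0))) :=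
        Continuous.tendsto (by fun_prop) 0
      rw [Prod.mk_zero_zero, add_zero] at this
      exact this.mono_left nhdsWithin_le_nhds
    obtain ⟨t, ht, ht0⟩ := ((hlim.eventually (mem_interior_iff_mem_nhds.1 h)).and
      self_mem_nhdsWithin).exists
    have := hle _ ht
    simp only [realPoint, Prod.mk_add_mk] at this
    linarith [show (0 : ℝ) < t from ht0]
  have hpos := homog_pos s
  refine ⟨(homog s 2).toNat, by omega, fun h => hnot ?_⟩
  have hz : dehomog ![homog s 0, homog s 1, ((homog s 2).toNat : ℤ)] = realPoint s := by
    rw [Int.toNat_of_nonneg hpos.le, ← dehomog_homog]; rfl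
  have : (homog s 0, homog s 1) ∈ dilateLatticePoints P (homog s 2).toNat := by
    rw [dilateLatticePoints, Set.mem_ofPred_eq, hz]; exact hsP
  rw [← h, dilateLatticePoints, Set.mem_ofPred_eq, hz] at this
  exact this

lemma periodic_minimumPeriod {f : ℤ → ℚ} (h : minimumPeriod f = 1) : Function.Periodic f 1 := by
  have hne : {s : ℕ | 0 < s ∧ Function.Periodic f (s : ℤ)}.Nonempty :=
    Nat.nonempty_of_sInf_eq_succ h
  have := (Nat.sInf_mem hne).2
  change Function.Periodic f ((minimumPeriod f : ℕ) : ℤ) at this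
  rwa [h, Nat.cast_one] at this

lemma eq_of_periodic_one {f : ℤ → ℚ} (h : Function.Periodic f 1) (n : ℤ) : f n = f 0 := by
  simpa using h.int_mul n 0

lemma finite_inter_integerLattice {P : Set (ℝ × ℝ)} (hP : Bornology.IsBounded P) :
    (P ∩ integerLattice).Finite := by
  refine ((finite_dilateLatticePoints hP one_pos).image
    fun z : ℤ × ℤ => ((z.1 : ℝ), (z.2 : ℝ))).subset ?_
  rintro _ ⟨h, x, rfl⟩
  exact ⟨x, by simpa [dilateLatticePoints, dehomog] using h, rfl⟩

lemma boundaryCount_add_interiorCount {P : Set (ℝ × ℝ)} (hP : IsCompact P) :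
    boundaryCount P + interiorCount P = latticePointEnumerator P 1 := by
  have hf := finite_inter_integerLattice (hP.isBounded.subset hP.isClosed.frontier_subset)
  have hi := finite_inter_integerLattice (hP.isBounded.subset (interior_subset (s := P)))
  have hd : Disjoint (frontier P ∩ integerLattice) (interior P ∩ integerLattice) :=
    disjoint_interior_frontier.symm.mono Set.inter_subset_left Set.inter_subset_left
  rw [latticePointEnumerator_one, boundaryCount, interiorCount, ← Set.ncard_union_eq hd hf hi,
    ← Set.union_inter_distrib_right, Set.union_comm, ← closure_eq_interior_union_frontier,
    hP.isClosed.closure_eq]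

/-- Pick's theorem for polygonal pseudo-integral polytopes: their Ehrhart polynomial is
`1 + a n + c n ^ 2`, where `2 a` is the number of boundary lattice points and
`1 - a + c` that of interior lattice points. -/
theorem IsPolygonalPIP.exists_coefficients {P : Set (ℝ × ℝ)} (hP : IsPolygonalPIP P) :
    ∃ a c : ℚ, a ≠ 0 ∧ 0 < c ∧ (boundaryCount P : ℚ) = 2 * a ∧
      (interiorCount P : ℚ) = 1 - a + c := by
  obtain ⟨⟨S, hS, hPS⟩, c, hc, hq⟩ := hP
  change ¬ Collinear ℝ (realPoint '' (S : Set (ℚ × ℚ))) at hS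
  change P = convexHull ℝ (realPoint '' (S : Set (ℚ × ℚ))) at hPS
  have hcomp : IsCompact P := hPS ▸ (S.finite_toSet.image realPoint).isCompact_convexHull ℝ
  obtain ⟨m, hm, hmne⟩ := exists_dilateLatticePoints_ne hS
  obtain ⟨E, hE, hE0, hEpos, hEneg⟩ := exists_isQuasiPolynomial_reciprocity hS
  rw [← hPS] at hmne hEpos hEneg
  have hq0 : minimumPeriod (c 0) = 1 := Nat.dvd_one.1 (hq ▸ Nat.dvd_lcm_left _ _)
  have hq12 : Nat.lcm (minimumPeriod (c 1)) (minimumPeriod (c 2)) = 1 :=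
    Nat.dvd_one.1 (hq ▸ Nat.dvd_lcm_right _ _)
  have hq1 : minimumPeriod (c 1) = 1 := Nat.dvd_one.1 (hq12 ▸ Nat.dvd_lcm_left _ _)
  have hq2 : minimumPeriod (c 2) = 1 := Nat.dvd_one.1 (hq12 ▸ Nat.dvd_lcm_right _ _)
  have c0 := eq_of_periodic_one (periodic_minimumPeriod hq0)
  have c1 := eq_of_periodic_one (periodic_minimumPeriod hq1)
  have c2 := eq_of_periodic_one (periodic_minimumPeriod hq2)
  have hlead : c 2 0 ≠ 0 := fun h => hc.leading_ne_zero (funext fun n => by rw [c2, h]; rfl)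
  have heval := hc.eval
  simp only [c0, c1, c2] at heval
  generalize c 0 0 = k₀ at *
  generalize c 1 0 = k₁ at *
  generalize c 2 0 = k₂ at *
  -- the Ehrhart polynomial agrees with `E` on the positive integers, hence on all integers
  have hEeq (n : ℤ) : E n = k₀ + k₁ * n + k₂ * (n : ℚ) ^ 2 := by
    have hd : E + (-1 : ℚ) • (fun n : ℤ => k₀ + k₁ * n + k₂ * (n : ℚ) ^ 2) = 0 := by
      refine (hE.add ((isQuasiPolynomial_quadratic k₀ k₁ k₂).smul (-1))).eq_zero ?_
      filter_upwards [eventually_gt_atTop 0] with n hn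
      lift n to ℕ using hn.le
      have hn' : 0 < n := by exact_mod_cast hn
      simp only [Pi.add_apply, Pi.smul_apply, smul_eq_mul]
      rw [hEpos n hn', heval n hn']
      push_cast; ring
    have := congrFun hd n
    simp only [Pi.add_apply, Pi.smul_apply, smul_eq_mul, Pi.zero_apply] at this
    linarith
  have hk₀ : k₀ = 1 := by simpa [hE0] using (hEeq 0).symm
  have hint (n : ℕ) (hn : 0 < n) :
      (latticePointEnumerator (interior P) n : ℚ) = 1 - k₁ * n + k₂ * (n : ℚ) ^ 2 := by
    rw [← hEneg n hn, hEeq, hk₀]; push_cast; ring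
  have hI : (interiorCount P : ℚ) = 1 - k₁ + k₂ := by
    have := hint 1 one_pos
    rw [latticePointEnumerator_one] at this
    simpa [interiorCount] using this
  refine ⟨k₁, k₂, ?_, ?_, ?_, hI⟩
  · rintro rfl
    refine hmne (Set.eq_of_subset_of_ncard_le (fun x hx => interior_subset (s := P) hx) ?_
      (finite_dilateLatticePoints hcomp.isBounded hm))
    rw [← latticePointEnumerator_eq_ncard _ hm, ← latticePointEnumerator_eq_ncard _ hm]
    have : (latticePointEnumerator P m : ℚ) = latticePointEnumerator (interior P) m := by
      rw [hint m hm, heval m hm, hk₀]; ring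
    exact le_of_eq (by exact_mod_cast this)
  · by_contra hneg
    have hneg : k₂ < 0 := lt_of_le_of_ne (not_lt.1 hneg) hlead
    obtain ⟨n, hn⟩ := exists_nat_gt (1 / -k₂)
    have hn0 : (0 : ℚ) < n := (one_div_pos.2 (neg_pos.2 hneg)).trans hn
    have hn1 : 0 < n := by exact_mod_cast hn0
    have hn2 : (1 : ℚ) ≤ n := by exact_mod_cast hn1
    rw [div_lt_iff₀ (neg_pos.2 hneg)] at hn
    have h1 := hint n hn1
    have h2 := heval n hn1
    have h3 : (0 : ℚ) ≤ latticePointEnumerator (interior P) n := Nat.cast_nonneg _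
    have h4 : (0 : ℚ) ≤ latticePointEnumerator P n := Nat.cast_nonneg _
    nlinarith
  · have := congrArg (Nat.cast : ℕ → ℚ) (boundaryCount_add_interiorCount hcomp)
    push_cast at this
    rw [hI, heval 1 one_pos, hk₀] at this
    push_cast at this
    linarith

/-! ### The kites -/

/-- The kite with diagonals from `(0, 0)` to `((e + 2) / 2, 0)` and from `(1, -e / (e + 2))` to
`(1, e / (e + 2))`, by its four linear inequalities. -/
def kite (e : ℕ) : Set (ℝ × ℝ) :=
  {p | (e + 2) * |p.2| ≤ e * p.1 ∧ (e + 2) * |p.2| ≤ (e + 2) - 2 * p.1}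

lemma mem_kite {e : ℕ} {p : ℝ × ℝ} :
    p ∈ kite e ↔ (e + 2) * |p.2| ≤ e * p.1 ∧ (e + 2) * |p.2| ≤ (e + 2) - 2 * p.1 := Iff.rfl

lemma convex_kite (e : ℕ) : Convex ℝ (kite e) := by
  intro p hp q hq a b ha hb hab
  rw [mem_kite] at *
  simp only [Prod.snd_add, Prod.smul_snd, Prod.fst_add, Prod.smul_fst, smul_eq_mul]
  have h1 : |a * p.2 + b * q.2| ≤ a * |p.2| + b * |q.2| := by
    simpa [abs_mul, abs_of_nonneg ha, abs_of_nonneg hb] using abs_add_le (a * p.2) (b * q.2)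
  have h2 : ((e : ℝ) + 2) * |a * p.2 + b * q.2| ≤
      a * ((e + 2) * |p.2|) + b * ((e + 2) * |q.2|) := by
    have := mul_le_mul_of_nonneg_left h1 (by positivity : (0 : ℝ) ≤ e + 2)
    linarith
  constructor
  · have := add_le_add (mul_le_mul_of_nonneg_left hp.1 ha) (mul_le_mul_of_nonneg_left hq.1 hb)
    linarith
  · have := add_le_add (mul_le_mul_of_nonneg_left hp.2 ha) (mul_le_mul_of_nonneg_left hq.2 hb)
    have e1 : a * ((e : ℝ) + 2) + b * (e + 2) = e + 2 := by rw [← add_mul, hab, one_mul]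
    linarith

/-- The vertices of the kite. -/
def kiteVertices (e : ℕ) : Finset (ℚ × ℚ) :=
  {(0, 0), (((e : ℚ) + 2) / 2, 0), (1, (e : ℚ) / (e + 2)), (1, -((e : ℚ) / (e + 2)))}

lemma realPoint_image_kiteVertices (e : ℕ) :
    realPoint '' (kiteVertices e : Set (ℚ × ℚ)) =
      {(0, 0), (((e : ℝ) + 2) / 2, 0), (1, (e : ℝ) / (e + 2)), (1, -((e : ℝ) / (e + 2)))} := by
  simp [kiteVertices, Set.image_insert_eq, realPoint]

lemma kite_eq_convexHull {e : ℕ} (he : 0 < e) :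
    kite e = convexHull ℝ (realPoint '' (kiteVertices e : Set (ℚ × ℚ))) := by
  have he' : (0 : ℝ) < e := by exact_mod_cast he
  have he2 : (0 : ℝ) < e + 2 := by positivity
  rw [realPoint_image_kiteVertices]
  set V : Set (ℝ × ℝ) :=
    {(0, 0), (((e : ℝ) + 2) / 2, 0), (1, (e : ℝ) / (e + 2)), (1, -((e : ℝ) / (e + 2)))} with hV
  apply Set.Subset.antisymm
  · intro p hp
    obtain ⟨h1, h2⟩ := mem_kite.1 hp
    have m0 : ((0, 0) : ℝ × ℝ) ∈ convexHull ℝ V := subset_convexHull ℝ _ (by simp [hV])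
    have m1 : ((((e : ℝ) + 2) / 2, 0) : ℝ × ℝ) ∈ convexHull ℝ V :=
      subset_convexHull ℝ _ (by simp [hV])
    have m2 : ((1, (e : ℝ) / (e + 2)) : ℝ × ℝ) ∈ convexHull ℝ V :=
      subset_convexHull ℝ _ (by simp [hV])
    have m3 : ((1, -((e : ℝ) / (e + 2))) : ℝ × ℝ) ∈ convexHull ℝ V :=
      subset_convexHull ℝ _ (by simp [hV])
    have hy1 : ((e : ℝ) + 2) * p.2 ≤ (e + 2) * |p.2| :=
      mul_le_mul_of_nonneg_left (le_abs_self _) he2.le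
    have hy2 : ((e : ℝ) + 2) * -p.2 ≤ (e + 2) * |p.2| :=
      mul_le_mul_of_nonneg_left (neg_le_abs _) he2.le
    have combine (v : ℝ × ℝ) (hv : v ∈ convexHull ℝ V) (α β γ : ℝ) (hα : 0 ≤ α) (hβ : 0 ≤ β)
        (hγ : 0 ≤ γ) (hsum : γ + α + β = 1)
        (hp1 : p.1 = γ * v.1 + α + β) (hp2 : p.2 = γ * v.2 + (α - β) * (e / (e + 2))) :
        p ∈ convexHull ℝ V := by
      have := (convex_convexHull ℝ V).sum_mem (t := Finset.univ) (w := ![γ, α, β])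
        (z := ![v, (1, (e : ℝ) / (e + 2)), (1, -((e : ℝ) / (e + 2)))])
        (by intro i _; fin_cases i <;> simpa)
        (by simpa [Fin.sum_univ_three] using hsum)
        (by intro i _; fin_cases i <;> simpa)
      convert this using 1
      rw [Fin.sum_univ_three]
      ext
      · simp [hp1]
      · simp [hp2]; ring
    rcases le_total p.1 1 with hx | hx
    · -- left of the short diagonal
      refine combine _ m0 ((p.1 + (e + 2) * p.2 / e) / 2) ((p.1 - (e + 2) * p.2 / e) / 2) (1 - p.1)
        ?_ ?_ (by linarith) (by ring) (by ring) ?_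
      · have : -p.1 ≤ (e + 2) * p.2 / e := by rw [le_div_iff₀ he']; linarith
        linarith
      · have : (e + 2) * p.2 / e ≤ p.1 := by rw [div_le_iff₀ he']; linarith
        linarith
      · field_simp; ring
    · -- right of the short diagonal
      refine combine _ m1 (((e + 2 - 2 * p.1) + (e + 2) * p.2) / e / 2)
        (((e + 2 - 2 * p.1) - (e + 2) * p.2) / e / 2) (2 * (p.1 - 1) / e) ?_ ?_ ?_ ?_ ?_ ?_
      · have : 0 ≤ (e + 2 - 2 * p.1) + (e + 2) * p.2 := by linarith
        positivity
      · have : 0 ≤ (e + 2 - 2 * p.1) - (e + 2) * p.2 := by linarith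
        positivity
      · have : 0 ≤ p.1 - 1 := by linarith
        positivity
      · field_simp; ring
      · field_simp; ring
      · field_simp; ring
  · refine convexHull_min ?_ (convex_kite e)
    have h : ((e : ℝ) + 2) * (e / (e + 2)) = e := by field_simp
    have h' : |(e : ℝ) / (e + 2)| = e / (e + 2) := abs_of_pos (by positivity)
    rintro p (rfl | rfl | rfl | rfl) <;> rw [mem_kite] <;> simp only [abs_neg, abs_zero, h', h] <;>
      constructor <;> nlinarith

lemma isRationalPolygon_kite {e : ℕ} (he : 0 < e) : IsRationalPolygon (kite e) := by
  refine ⟨kiteVertices e, ?_, kite_eq_convexHull he⟩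
  change ¬ Collinear ℝ (realPoint '' (kiteVertices e : Set (ℚ × ℚ)))
  have he' : (0 : ℝ) < e := by exact_mod_cast he
  rw [realPoint_image_kiteVertices, collinear_iff_of_mem (p₀ := (0, 0)) (by simp)]
  rintro ⟨v, hv⟩
  obtain ⟨r, hr⟩ := hv (((e : ℝ) + 2) / 2, 0) (by simp)
  obtain ⟨s, hs⟩ := hv (1, (e : ℝ) / (e + 2)) (by simp)
  have r1 := congrArg Prod.fst hr
  have r2 := congrArg Prod.snd hr
  have s2 := congrArg Prod.snd hs
  simp only [vadd_eq_add, Prod.mk_zero_zero, add_zero, Prod.smul_fst, Prod.smul_snd,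
    smul_eq_mul] at r1 r2 s2
  rcases mul_eq_zero.1 r2.symm with h | h
  · rw [h, zero_mul] at r1
    have : (0 : ℝ) < (e + 2) / 2 := by positivity
    linarith
  · rw [h, mul_zero] at s2
    have : (0 : ℝ) < e / (e + 2) := by positivity
    linarith

/-- The lattice points in the upper half of the `n`-th dilate of the kite. -/
def upperKitePoints (e n : ℕ) : Set (ℤ × ℤ) :=
  {x | 0 ≤ x.2 ∧ (e + 2) * x.2 ≤ e * x.1 ∧ (e + 2) * x.2 ≤ (e + 2) * n - 2 * x.1}

lemma mem_dilateLatticePoints_kite {e n : ℕ} (hn : 0 < n) (x : ℤ × ℤ) :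
    x ∈ dilateLatticePoints (kite e) n ↔
      (e + 2) * |x.2| ≤ e * x.1 ∧ (e + 2) * |x.2| ≤ (e + 2) * n - 2 * x.1 := by
  have hn' : (0 : ℝ) < n := by exact_mod_cast hn
  have e1 : ((e : ℝ) + 2) * |(x.2 : ℝ) / n| = (e + 2) * |(x.2 : ℝ)| / n := by
    rw [abs_div, abs_of_pos hn', mul_div_assoc]
  have e2 : ((e : ℝ) + 2) - 2 * ((x.1 : ℝ) / n) = ((e + 2) * n - 2 * x.1) / n := by
    field_simp
  change dehomog ![x.1, x.2, (n : ℤ)] ∈ kite e ↔ _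
  rw [mem_kite]
  simp only [dehomog, cons_val_zero, cons_val_one, cons_val, Int.cast_natCast]
  rw [e1, e2, ← mul_div_assoc, div_le_div_iff_of_pos_right hn', div_le_div_iff_of_pos_right hn']
  norm_cast

/-- The triangle `{(i, j) | 0 ≤ i ≤ n, 0 ≤ 2 j ≤ e i}`, onto which a piecewise unimodular map
carries the upper half of the kite. -/
def straightenedPoints (e n : ℕ) : Finset (Σ _ : ℕ, ℕ) :=
  (Finset.range (n + 1)).sigma fun i => Finset.range (e * i / 2 + 1)

lemma mem_straightenedPoints {e n : ℕ} {t : Σ _ : ℕ, ℕ} :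
    t ∈ straightenedPoints e n ↔ t.1 ≤ n ∧ 2 * t.2 ≤ e * t.1 := by
  simp only [straightenedPoints, Finset.mem_sigma, Finset.mem_range]
  omega

/-- The piecewise unimodular map from the straightened triangle to the upper half of the kite: a
shear, followed on one side of the vertical line `x = n` by a second shear along this line. -/
def unstraighten (n : ℕ) (t : Σ _ : ℕ, ℕ) : ℤ × ℤ :=
  if t.1 + t.2 ≤ n then ((t.1 : ℤ) + t.2, t.2) else ((t.1 : ℤ) + t.2, n - t.1)

lemma unstraighten_injective (n : ℕ) : Function.Injective (unstraighten n) := by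
  rintro ⟨i, j⟩ ⟨i', j'⟩ h
  simp only [unstraighten] at h
  have : i = i' ∧ j = j' := by
    split_ifs at h <;> simp only [Prod.mk.injEq] at h <;> omega
  rw [this.1, this.2]

lemma image_unstraighten {e : ℕ} (he : 0 < e) (n : ℕ) :
    unstraighten n '' straightenedPoints e n = upperKitePoints e n := by
  have he' : (0 : ℤ) < e := by exact_mod_cast he
  ext ⟨x, y⟩
  constructor
  · rintro ⟨⟨i, j⟩, ht, h⟩
    obtain ⟨h1, h2⟩ := mem_straightenedPoints.1 ht
    simp only at h1 h2
    have h1' : (i : ℤ) ≤ n := by exact_mod_cast h1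
    have h2' : 2 * (j : ℤ) ≤ e * i := by exact_mod_cast h2
    simp only [unstraighten] at h
    split_ifs at h with h3
    · have h3' : (i : ℤ) + j ≤ n := by exact_mod_cast h3
      obtain ⟨rfl, rfl⟩ := Prod.mk.inj h
      have := mul_le_mul_of_nonneg_left h3' he'.le
      refine ⟨by simp, ?_, ?_⟩ <;> simp only [] <;> nlinarith
    · have h3' : (n : ℤ) < i + j := by exact_mod_cast not_le.1 h3
      obtain ⟨rfl, rfl⟩ := Prod.mk.inj h
      have := mul_le_mul_of_nonneg_left h3'.le he'.le
      refine ⟨by simpa using h1, ?_, ?_⟩ <;> simp only [] <;> nlinarith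
  · rintro ⟨h1, h2, h3⟩
    simp only at h1 h2 h3
    have hxy : y ≤ x := by
      by_contra hc
      nlinarith
    by_cases hx : x ≤ n
    · refine ⟨⟨(x - y).toNat, y.toNat⟩, mem_straightenedPoints.2 ⟨?_, ?_⟩, ?_⟩
      · simp only []; omega
      · simp only []
        zify
        rw [Int.toNat_of_nonneg h1, Int.toNat_of_nonneg (by omega)]
        linarith
      · rw [unstraighten, if_pos (by simp only []; omega)]
        ext <;> simp only [] <;> omega
    · have hyn : y ≤ n := by
        by_contra hc
        nlinarith
      refine ⟨⟨(n - y).toNat, (y + x - n).toNat⟩, mem_straightenedPoints.2 ⟨?_, ?_⟩, ?_⟩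
      · simp only []; omega
      · simp only []
        zify
        rw [Int.toNat_of_nonneg (by omega), Int.toNat_of_nonneg (by omega)]
        linarith
      · rw [unstraighten, if_neg (by simp only []; omega)]
        ext <;> simp only [] <;> omega

lemma ncard_upperKitePoints {e : ℕ} (he : 0 < e) (n : ℕ) :
    (upperKitePoints e n).ncard = ∑ i ∈ Finset.range (n + 1), (e * i / 2 + 1) := by
  rw [← image_unstraighten he, Set.ncard_image_of_injective _ (unstraighten_injective n),
    Set.ncard_coe_finset, straightenedPoints, Finset.card_sigma]
  simp

lemma finite_upperKitePoints {e : ℕ} (he : 0 < e) (n : ℕ) : (upperKitePoints e n).Finite := by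
  rw [← image_unstraighten he]
  exact (Finset.finite_toSet _).image _

lemma ncard_axisKitePoints (e n : ℕ) :
    {x : ℤ × ℤ | x.2 = 0 ∧ 0 ≤ x.1 ∧ 2 * x.1 ≤ (e + 2) * n}.ncard = (e + 2) * n / 2 + 1 := by
  have : {x : ℤ × ℤ | x.2 = 0 ∧ 0 ≤ x.1 ∧ 2 * x.1 ≤ (e + 2) * n} =
      (fun k : ℕ => ((k : ℤ), (0 : ℤ))) '' (Finset.range ((e + 2) * n / 2 + 1) : Set ℕ) := by
    ext ⟨x, y⟩
    simp only [Set.mem_ofPred_eq, Finset.coe_range, Set.mem_image, Set.mem_Iio, Prod.mk.injEq]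
    constructor
    · rintro ⟨rfl, h1, h2⟩
      lift x to ℕ using h1
      refine ⟨x, ?_, rfl, rfl⟩
      have : 2 * x ≤ (e + 2) * n := by exact_mod_cast h2
      omega
    · rintro ⟨k, hk, rfl, rfl⟩
      refine ⟨rfl, by simp, ?_⟩
      have : 2 * k ≤ (e + 2) * n := by omega
      exact_mod_cast this
  rw [this, Set.ncard_image_of_injective, Set.ncard_coe_finset, Finset.card_range]
  intro a b h
  simpa using h

/-- The upper and lower halves of the kite overlap in its long diagonal. -/
lemma latticePointEnumerator_kite_add {e n : ℕ} (he : 0 < e) (hn : 0 < n) :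
    latticePointEnumerator (kite e) n + ((e + 2) * n / 2 + 1) =
      2 * ∑ i ∈ Finset.range (n + 1), (e * i / 2 + 1) := by
  have he' : (0 : ℤ) < e := by exact_mod_cast he
  -- the reflection in the horizontal axis
  set σ : ℤ × ℤ → ℤ × ℤ := fun x => (x.1, -x.2) with hσ
  have hinj : Function.Injective σ := by
    rintro ⟨a, b⟩ ⟨c, d⟩ h
    simpa [hσ] using h
  have hmem (x : ℤ × ℤ) : x ∈ σ '' upperKitePoints e n ↔ σ x ∈ upperKitePoints e n := by
    constructor
    · rintro ⟨y, hy, rfl⟩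
      simpa [hσ] using hy
    · exact fun h => ⟨σ x, h, by simp [hσ]⟩
  have hfin := finite_upperKitePoints he n
  have hunion : dilateLatticePoints (kite e) n =
      upperKitePoints e n ∪ σ '' upperKitePoints e n := by
    ext x
    rw [Set.mem_union, hmem, mem_dilateLatticePoints_kite hn]
    change _ ↔ (0 ≤ x.2 ∧ _ ∧ _) ∨ (0 ≤ -x.2 ∧ (e + 2) * -x.2 ≤ e * x.1 ∧
      (e + 2) * -x.2 ≤ (e + 2) * n - 2 * x.1)
    rcases le_total 0 x.2 with h | h
    · rw [abs_of_nonneg h]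
      refine ⟨fun h' => Or.inl ⟨h, h'⟩, ?_⟩
      rintro (h' | ⟨h0, h'⟩)
      · exact h'.2
      · have : x.2 = 0 := by omega
        simpa [this] using h'
    · rw [abs_of_nonpos h]
      refine ⟨fun h' => Or.inr ⟨by omega, h'⟩, ?_⟩
      rintro (⟨h0, h'⟩ | h')
      · have : x.2 = 0 := by omega
        simpa [this] using h'
      · exact h'.2
  have hinter : upperKitePoints e n ∩ σ '' upperKitePoints e n =
      {x : ℤ × ℤ | x.2 = 0 ∧ 0 ≤ x.1 ∧ 2 * x.1 ≤ (e + 2) * n} := by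
    ext x
    rw [Set.mem_inter_iff, hmem]
    change (0 ≤ x.2 ∧ (e + 2) * x.2 ≤ e * x.1 ∧ (e + 2) * x.2 ≤ (e + 2) * n - 2 * x.1) ∧
      (0 ≤ -x.2 ∧ _ ∧ _) ↔ x.2 = 0 ∧ 0 ≤ x.1 ∧ 2 * x.1 ≤ (e + 2) * n
    constructor
    · rintro ⟨⟨h1, h2, h3⟩, h4, -⟩
      have h0 : x.2 = 0 := by omega
      rw [h0, mul_zero] at h2 h3
      exact ⟨h0, nonneg_of_mul_nonneg_right h2 he', by linarith⟩
    · rintro ⟨h1, h2, h3⟩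
      have := mul_nonneg he'.le h2
      simp only [hσ, h1, neg_zero, mul_zero, le_refl, true_and, and_self]
      exact ⟨this, by linarith⟩
  rw [latticePointEnumerator_eq_ncard _ hn, hunion, ← ncard_axisKitePoints, ← hinter,
    Set.ncard_union_add_ncard_inter _ _ hfin (hfin.image σ), Set.ncard_image_of_injective _ hinj,
    ncard_upperKitePoints he]
  ring

/-- The count of the straightened triangle against that of the long diagonal: for odd `e` both
depend on the parity of `n`, and the two dependences cancel. -/
lemma four_mul_sum_floor (e n : ℕ) :
    4 * ∑ i ∈ Finset.range (n + 1), (e * i / 2 + 1) =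
      2 + (2 - e % 2) * n + e * n ^ 2 + 2 * ((e + 2) * n / 2 + 1) := by
  induction n with
  | zero => simp
  | succ n ih =>
    rw [Finset.sum_range_succ, mul_add, ih]
    have h1 : e * (n + 1) = e * n + e := by ring
    have h2 : (e + 2) * n = e * n + 2 * n := by ring
    have h3 : (e + 2) * (n + 1) = e * n + e + 2 * n + 2 := by ring
    have h4 : e * (n + 1) ^ 2 = e * n ^ 2 + 2 * (e * n) + e := by ring
    have h5 : (e * n) % 2 = (e % 2) * (n % 2) % 2 := Nat.mul_mod _ _ _
    rw [h1, h2, h3, h4]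
    generalize e * n = p at *
    generalize e * n ^ 2 = q at *
    rcases Nat.mod_two_eq_zero_or_one e with h | h <;> rw [h] at h5 ⊢ <;> omega

lemma latticePointEnumerator_kite {e n : ℕ} (he : 0 < e) (hn : 0 < n) :
    2 * latticePointEnumerator (kite e) n = 2 + (2 - e % 2) * n + e * n ^ 2 := by
  have h1 := latticePointEnumerator_kite_add he hn
  have h2 := four_mul_sum_floor e n
  omega

lemma minimumPeriod_const (a : ℚ) : minimumPeriod (fun _ => a) = 1 := by
  have hmem : 1 ∈ {s : ℕ | 0 < s ∧ Function.Periodic (fun _ : ℤ => a) (s : ℤ)} :=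
    ⟨one_pos, fun _ => rfl⟩
  exact le_antisymm (Nat.sInf_le hmem) (Nat.sInf_mem ⟨_, hmem⟩).1

lemma isPolygonalPIP_kite {e : ℕ} (he : 0 < e) : IsPolygonalPIP (kite e) := by
  refine ⟨isRationalPolygon_kite he,
    ![fun _ => 1, fun _ => ((2 - e % 2 : ℕ) : ℚ) / 2, fun _ => (e : ℚ) / 2], ⟨?_, ?_, ?_⟩, ?_⟩
  · intro i
    refine ⟨1, one_pos, ?_⟩
    fin_cases i <;> exact fun _ => rfl
  · intro h
    have := congrFun h 0
    simp only [cons_val, Pi.zero_apply] at this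
    have : (0 : ℚ) < e / 2 := by positivity
    linarith
  · intro n hn
    have := congrArg (Nat.cast : ℕ → ℚ) (latticePointEnumerator_kite he hn)
    rw [Nat.cast_mul, Nat.cast_add, Nat.cast_add, Nat.cast_mul, Nat.cast_mul, Nat.cast_pow] at this
    simp only [cons_val_zero, cons_val_one, cons_val]
    rw [Nat.cast_ofNat] at this
    linarith
  · simp [quasiPeriod, minimumPeriod_const]

lemma mem_interior_kite_iff {e : ℕ} (he : 0 < e) (x y : ℤ) :
    ((x : ℝ), (y : ℝ)) ∈ interior (kite e) ↔ y = 0 ∧ 0 < x ∧ 2 * x < e + 2 := by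
  have he' : (0 : ℝ) < e := by exact_mod_cast he
  constructor
  · intro h
    have hsub : kite e ⊆ Set.Icc 0 (((e : ℝ) + 2) / 2) ×ˢ Set.univ := by
      intro p hp
      obtain ⟨h1, h2⟩ := mem_kite.1 hp
      have h3 : 0 ≤ ((e : ℝ) + 2) * |p.2| := by positivity
      exact ⟨⟨nonneg_of_mul_nonneg_right (h3.trans h1) he', by linarith⟩, trivial⟩
    have h' := interior_mono hsub h
    rw [interior_prod_eq, interior_Icc] at h'
    obtain ⟨hx1, hx2⟩ := h'.1
    simp only at hx1 hx2
    have hx1' : 0 < x := by exact_mod_cast hx1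
    have hx2' : 2 * x < e + 2 := by
      have : 2 * (x : ℝ) < e + 2 := by linarith
      exact_mod_cast this
    refine ⟨?_, hx1', hx2'⟩
    have h2 := (mem_kite.1 (interior_subset h)).2
    simp only at h2
    have h3 : |(y : ℝ)| < 1 := by
      by_contra hc
      nlinarith [not_lt.1 hc]
    have h4 : |y| < 1 := by exact_mod_cast h3
    exact Int.abs_lt_one_iff.1 h4
  · rintro ⟨rfl, h1, h2⟩
    have h1' : (0 : ℝ) < x := by exact_mod_cast h1
    have h2' : 2 * (x : ℝ) < e + 2 := by exact_mod_cast h2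
    refine mem_interior.2 ⟨{p | (e + 2) * |p.2| < e * p.1 ∧ (e + 2) * |p.2| < (e + 2) - 2 * p.1},
      fun p hp => ⟨hp.1.le, hp.2.le⟩, ?_, ?_⟩
    · have o1 : IsOpen {p : ℝ × ℝ | ((e : ℝ) + 2) * |p.2| < e * p.1} :=
        isOpen_lt (by fun_prop) (by fun_prop)
      have o2 : IsOpen {p : ℝ × ℝ | ((e : ℝ) + 2) * |p.2| < (e + 2) - 2 * p.1} :=
        isOpen_lt (by fun_prop) (by fun_prop)
      exact o1.inter o2
    · constructor
      · simp; positivity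
      · simp; linarith

lemma interiorCount_kite {e I : ℕ} (he : 0 < e) (hI : e + 2 = 2 * I + 1 ∨ e + 2 = 2 * I + 2) :
    interiorCount (kite e) = I := by
  have : interior (kite e) ∩ integerLattice =
      (fun k : ℕ => ((k : ℝ), (0 : ℝ))) '' (Finset.Icc 1 I : Set ℕ) := by
    ext p
    simp only [Set.mem_inter_iff, integerLattice, Set.mem_range, Set.mem_image, Finset.coe_Icc,
      Set.mem_Icc]
    constructor
    · rintro ⟨h, ⟨x, y⟩, rfl⟩
      obtain ⟨rfl, h1, h2⟩ := (mem_interior_kite_iff he x y).1 h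
      exact ⟨x.toNat, by omega, by simp [show ((x.toNat : ℕ) : ℝ) = x by
        exact_mod_cast Int.toNat_of_nonneg h1.le]⟩
    · rintro ⟨k, hk, rfl⟩
      have := (mem_interior_kite_iff he k 0).2 ⟨rfl, by omega, by omega⟩
      simp only [Int.cast_natCast, Int.cast_zero] at this
      exact ⟨this, (k, 0), by simp⟩
  rw [interiorCount, this, Set.ncard_image_of_injective, Set.ncard_coe_finset, Nat.card_Icc]
  · omega
  · intro a b h
    simpa using h

lemma boundaryCount_kite {e I b : ℕ} (he : 0 < e) (hb : b = 1 ∨ b = 2) (hI : e + 2 = 2 * I + b) :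
    boundaryCount (kite e) = b := by
  have hcomp : IsCompact (kite e) := kite_eq_convexHull he ▸
    ((kiteVertices e).finite_toSet.image realPoint).isCompact_convexHull ℝ
  have h1 := boundaryCount_add_interiorCount hcomp
  have h2 := latticePointEnumerator_kite he one_pos
  rw [interiorCount_kite (I := I) he (by omega)] at h1
  simp only [mul_one, one_pow] at h2
  omega

/-! ### Interior and boundary lattice points of polygonal PIPs -/

theorem theorem2 :
    (∀ I b : ℕ, 1 ≤ I → (b = 1 ∨ b = 2) →
      ∃ P : Set (ℝ × ℝ), IsPolygonalPIP P ∧ interiorCount P = I ∧ boundaryCount P = b) ∧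
    (¬ ∃ P : Set (ℝ × ℝ), IsPolygonalPIP P ∧ boundaryCount P = 0) ∧
    (¬ ∃ P : Set (ℝ × ℝ), IsPolygonalPIP P ∧ interiorCount P = 0 ∧ boundaryCount P = 1) ∧
    (¬ ∃ P : Set (ℝ × ℝ), IsPolygonalPIP P ∧ interiorCount P = 0 ∧ boundaryCount P = 2) := by
  refine ⟨fun I b hI hb => ?_, ?_, ?_, ?_⟩
  · have he : 0 < 2 * I + b - 2 := by omega
    exact ⟨kite (2 * I + b - 2), isPolygonalPIP_kite he, interiorCount_kite (I := I) he (by omega),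
      boundaryCount_kite (I := I) he hb (by omega)⟩
  · rintro ⟨P, hP, hb⟩
    obtain ⟨a, c, ha, -, h, -⟩ := hP.exists_coefficients
    rw [hb, Nat.cast_zero] at h
    exact ha (by linarith)
  · rintro ⟨P, hP, hI, hb⟩
    obtain ⟨a, c, -, hc, h, h'⟩ := hP.exists_coefficients
    rw [hb, Nat.cast_one] at h
    rw [hI, Nat.cast_zero] at h'
    linarith
  · rintro ⟨P, hP, hI, hb⟩
    obtain ⟨a, c, -, hc, h, h'⟩ := hP.exists_coefficients
    rw [hb, Nat.cast_ofNat] at h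
    rw [hI, Nat.cast_zero] at h'
    linarith

end
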